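/- Let $(M,g)$ be a smooth Riemannian manifold of dimension $4m$, $m>1$, with Levi-Civita connection $\nabla^g$. Let $\mathcal Q\subset \mathrm{End}(TM)$ be a smooth subbundle that has, near every point, a smooth local frame $J_1,J_2,J_3$ with $J_aJ_b=-\delta_{ab}\,\mathrm{id}+\varepsilon_{abc}J_c$, and assume that every $J\in\mathcal Q_x$ with $J^2=-\mathrm{id}$ is orthogonal for $g$. Regard $\mathcal Q$ as a bundle of $2$-forms through $J\mapsto\omega_J$, $\omega_J(X,Y)=g(JX,Y)$, and put $\omega_i=\omega_{J_i}$, $\Theta^\wedge=\sum_{i=1}^3\omega_i\wedge\omega_i$ and $$\Theta=\sum_{i=1}^3\omega_i\otimes\omega_i ,\qquad \Theta_V=\sum_{i=1}^3(\imath_V\omega_i)\otimes\omega_i ,$$ which do not depend on the local frame. Assume that $(M,g,\mathcal Q)$ is quaternionic Kähler, that is, $\nabla^g\Theta^\wedge=0$, and that its scalar curvature vanishes nowhere. A vector field $V$ is a quaternionic Kähler Killing vector field if $\mathcal L_Vg=0$ and $\mathcal L_V\Theta^\wedge=0$. Let $K\subset TM$ be a smooth vector subbundle whose sections are closed under the Lie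 bracket, regarded as a Lie algebroid over $M$ with the inclusion as its anchor, and suppose that $\nabla^g$ restricts to a connection on $K$. Suppose that $K$ is generated by a Lie algebra $\mathfrak k\subset\Gamma(K)$ of quaternionic Kähler Killing vector fields, that is, $K_x=\{V(x): V\in\mathfrak k\}$ for every $x\in M$. Let $f\in\Gamma(K^*\otimes\mathcal Q)$, write $f_V=f(V)$ for $V\in\Gamma(K)$, and suppose that $f$ is a Galicki–Lawson momentum map for $\mathfrak k$, that is, $\nabla^g f_V=\Theta_V$ for all $V\in\mathfrak k$. Then $f$ is a $\mathcal Q$-valued homotopy momentum section for $\Theta$ with respect to $(K,\nabla^g)$, that is, $$\nabla^g_X(f_V)-f_{\nabla^g_XV}=\Theta(V,X)\quad\text{and}\quad \nabla^g_{V}(f_{W})-\nabla^g_{W}(f_{V})-f_{[V,W]}=-\Theta(V,W)$$ for all vector fields $X$ on $M$ and all $V,W\in\Gamma(K)$, if and only if $$f_{[V_1,V_2]}=-\sum_{i=1}^3\omega_i(V_1,V_2)\,\omega_i\qquad\text{for all }V_1,V_2\in\mathfrak k .$$ -/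

import Mathlib

open Bundle Manifold ContDiff Module

noncomputable section

namespace QuatKaehler

/-! ### Smooth vector fields, covariant tensors and the Levi-Civita connection

`M` is a manifold without boundary, modelled on a finite-dimensional real vector space `E`. -/

section Basics

variable {E : Type*} [NormedAddCommGroup E] [NormedSpace ℝ E]
  {M : Type*} [TopologicalSpace M] [ChartedSpace E M]

/-- The tangent space at a point. -/
abbrev Tan (E : Type*) [NormedAddCommGroup E] [NormedSpace ℝ E]
    {M : Type*} [TopologicalSpace M] [ChartedSpace E M] (x : M) : Type _ :=
  TangentSpace 𝓘(ℝ, E) x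

/-- Bilinear forms on the tangent space at a point. -/
abbrev Bil (E : Type*) [NormedAddCommGroup E] [NormedSpace ℝ E]
    {M : Type*} [TopologicalSpace M] [ChartedSpace E M] (x : M) : Type _ :=
  Tan E x →L[ℝ] Tan E x →L[ℝ] ℝ

/-- Endomorphisms of the tangent space at a point. -/
abbrev EndT (E : Type*) [NormedAddCommGroup E] [NormedSpace ℝ E]
    {M : Type*} [TopologicalSpace M] [ChartedSpace E M] (x : M) : Type _ :=
  Tan E x →L[ℝ] Tan E x

variable [IsManifold 𝓘(ℝ, E) ∞ M]

/-- The space `𝔛(M)` of smooth vector fields. -/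
abbrev VField (E : Type*) [NormedAddCommGroup E] [NormedSpace ℝ E]
    (M : Type*) [TopologicalSpace M] [ChartedSpace E M] [IsManifold 𝓘(ℝ, E) ∞ M] : Type _ :=
  ContMDiffSection 𝓘(ℝ, E) E ∞ (fun x : M => Tan E x)

/-- Smooth Riemannian metrics on `M`. -/
abbrev Metric (E : Type*) [NormedAddCommGroup E] [NormedSpace ℝ E]
    (M : Type*) [TopologicalSpace M] [ChartedSpace E M] [IsManifold 𝓘(ℝ, E) ∞ M] : Type _ :=
  ContMDiffRiemannianMetric 𝓘(ℝ, E) ∞ E (fun x : M => Tan E x)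

/-- Affine connections on `M`; `D Y x u` is `(∇_u Y)(x)`. -/
abbrev Conn (E : Type*) [NormedAddCommGroup E] [NormedSpace ℝ E]
    (M : Type*) [TopologicalSpace M] [ChartedSpace E M] [IsManifold 𝓘(ℝ, E) ∞ M] : Type _ :=
  CovariantDerivative 𝓘(ℝ, E) E (fun x : M => Tan E x)

/-- The derivative `X h` of a function along a vector field. -/
def dirDeriv (X : VField E M) (h : M → ℝ) : M → ℝ :=
  fun x => mvfderiv 𝓘(ℝ, E) h x (X x)

/-- The Lie bracket of two smooth vector fields, as a smooth vector field. -/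
def lieBr [FiniteDimensional ℝ E] (X Y : VField E M) : VField E M where
  toFun := VectorField.mlieBracket 𝓘(ℝ, E) X Y
  contMDiff_toFun := by
    have : CompleteSpace E := FiniteDimensional.complete ℝ E
    have : IsManifold 𝓘(ℝ, E) (((⊤ : ℕ∞) : ℕ∞ω) + 1) M := by
      have h : (((⊤ : ℕ∞) : ℕ∞ω) + 1) = ∞ := rfl
      rw [h]; infer_instance
    have : IsManifold 𝓘(ℝ, E) (minSmoothness ℝ 2) M := by
      rw [minSmoothness_of_isRCLikeNormedField]; infer_instance
    exact ContDiff.mlieBracket_vectorField (m := ⊤) (n := ⊤) X.contMDiff Y.contMDiff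
      (by simp)

/-- The vector field `∇_X Y` of a smooth connection. -/
def nabla (D : Conn E M) [hD : D.ContMDiffCovariantDerivative ∞] (X Y : VField E M) :
    VField E M where
  toFun := fun x => D Y x (X x)
  contMDiff_toFun := by
    have h : ContMDiffOn 𝓘(ℝ, E) (𝓘(ℝ, E).prod 𝓘(ℝ, E →L[ℝ] E)) ∞
        (fun x : M => (⟨x, D Y x⟩ : TotalSpace (E →L[ℝ] E) (fun x : M => EndT E x))) Set.univ :=
      hD.contMDiff.contMDiff (Y.contMDiff.contMDiffOn (s := Set.univ))
    rw [contMDiffOn_univ] at h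
    exact h.clm_bundle_apply X.contMDiff

/-- `D` is the Levi-Civita connection of `g`: it is torsion-free and metric. -/
structure IsLeviCivita [FiniteDimensional ℝ E] (g : Metric E M) (D : Conn E M)
    [D.ContMDiffCovariantDerivative ∞] : Prop where
  torsion_free : ∀ X Y : VField E M, nabla D X Y - nabla D Y X = lieBr X Y
  metric : ∀ (X Y Z : VField E M) (x : M),
    dirDeriv X (fun y => g.inner y (Y y) (Z y)) x =
      g.inner x (nabla D X Y x) (Z x) + g.inner x (Y x) (nabla D X Z x)

/-- A covariant `2`-tensor (not assumed to be function-linear), as a map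
`𝔛(M) × 𝔛(M) → C^∞(M)`. -/
abbrev Tensor₂ (E : Type*) [NormedAddCommGroup E] [NormedSpace ℝ E]
    (M : Type*) [TopologicalSpace M] [ChartedSpace E M] [IsManifold 𝓘(ℝ, E) ∞ M] : Type _ :=
  VField E M → VField E M → M → ℝ

/-- The tensor with value `β x` at `x`, evaluated on vector fields. -/
def Tensor₂.ofField (β : ∀ x : M, Bil E x) : Tensor₂ E M := fun Y Z x => β x (Y x) (Z x)

/-- The induced connection on covariant `2`-tensors:
`(∇_X β)(Y, Z) = X (β(Y, Z)) - β(∇_X Y, Z) - β(Y, ∇_X Z)`. -/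
def nablaTensor₂ (D : Conn E M) [D.ContMDiffCovariantDerivative ∞] (X : VField E M)
    (β : Tensor₂ E M) : Tensor₂ E M :=
  fun Y Z => dirDeriv X (β Y Z) - β (nabla D X Y) Z - β Y (nabla D X Z)

/-- The derivation of a covariant `4`-tensor `Ω` which extends the derivative of functions along
`X` and the operator `L` on vector fields:
`X (Ω(Y₁, …, Y₄)) - ∑ Ω(Y₁, …, L Yᵢ, …, Y₄)`.
It is `∇_X Ω` when `L = ∇_X`, and the Lie derivative `ℒ_X Ω` when `L = [X, ·]`. -/
def deriv₄ (X : VField E M) (L : VField E M → VField E M)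
    (Ω : ∀ x : M, Tan E x → Tan E x → Tan E x → Tan E x → ℝ)
    (Y₁ Y₂ Y₃ Y₄ : VField E M) (x : M) : ℝ :=
  dirDeriv X (fun y => Ω y (Y₁ y) (Y₂ y) (Y₃ y) (Y₄ y)) x
    - Ω x (L Y₁ x) (Y₂ x) (Y₃ x) (Y₄ x) - Ω x (Y₁ x) (L Y₂ x) (Y₃ x) (Y₄ x)
    - Ω x (Y₁ x) (Y₂ x) (L Y₃ x) (Y₄ x) - Ω x (Y₁ x) (Y₂ x) (Y₃ x) (L Y₄ x)

/-- The curvature `R(u, v) w = ∇_u ∇_v w - ∇_v ∇_u w - ∇_{[u, v]} w` at `x`, computed with smooth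
local extensions of the three tangent vectors. -/
def curvature (D : Conn E M) (x : M) (u v w : Tan E x) : Tan E x :=
  let U : ∀ y : M, Tan E y := FiberBundle.extend E u
  let V : ∀ y : M, Tan E y := FiberBundle.extend E v
  let W : ∀ y : M, Tan E y := FiberBundle.extend E w
  D (fun y => D W y (V y)) x u - D (fun y => D W y (U y)) x v
    - D W x (VectorField.mlieBracket 𝓘(ℝ, E) U V x)

/-- A basis of the tangent space at `x`. -/
def tanBasis [FiniteDimensional ℝ E] (x : M) : Basis (Fin (finrank ℝ E)) ℝ (Tan E x) :=
  (finBasis ℝ E : Basis (Fin (finrank ℝ E)) ℝ E)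

/-- The Ricci curvature `Ric(v, w) = tr (u ↦ R(u, v) w)`. -/
def ricci [FiniteDimensional ℝ E] (D : Conn E M) (x : M) (v w : Tan E x) : ℝ :=
  ∑ i, (tanBasis x).repr (curvature D x (tanBasis x i) v w) i

/-- The scalar curvature `∑ g^{jk} Ric_{jk}`. -/
def scalarCurvature [FiniteDimensional ℝ E] (g : Metric E M) (D : Conn E M) (x : M) : ℝ :=
  ∑ j, ∑ k, (Matrix.of fun a b => g.inner x (tanBasis x a) (tanBasis x b))⁻¹ j k *
    ricci D x (tanBasis x j) (tanBasis x k)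

end Basics

/-! ### Quaternionic Kähler manifolds -/

section Quaternionic

variable {E : Type*} [NormedAddCommGroup E] [NormedSpace ℝ E]
  {M : Type*} [TopologicalSpace M] [ChartedSpace E M]

/-- Three endomorphisms with the quaternionic relations
`J_a J_b = -δ_{ab} id + ε_{abc} J_c` (indices modulo `3`) which span `Q`. -/
structure IsQuatBasis {x : M} (Q : Submodule ℝ (EndT E x)) (J : Fin 3 → EndT E x) : Prop where
  sq : ∀ i, (J i).comp (J i) = -ContinuousLinearMap.id ℝ (Tan E x)
  mul : ∀ i, (J i).comp (J (i + 1)) = J (i + 2)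
  mul_rev : ∀ i, (J (i + 1)).comp (J i) = -J (i + 2)
  span : Submodule.span ℝ (Set.range J) = Q

variable [IsManifold 𝓘(ℝ, E) ∞ M]

/-- The form `ω_J(u, v) = g(J u, v)`. -/
def omega (g : Metric E M) (x : M) (J : EndT E x) : Bil E x := (g.inner x).comp J

open Classical in
/-- `Θ = ∑ᵢ ωᵢ ⊗ ωᵢ` at `x`, for a quaternionic basis of `Q x`: the value of the
`Q`-valued `2`-form `Θ` on `u, v` is the bilinear form `∑ᵢ ωᵢ(u, v) ωᵢ`.  It does not depend on
the quaternionic basis, see `Theta_eq`. -/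
def Theta (g : Metric E M) (Q : ∀ x : M, Submodule ℝ (EndT E x)) (x : M) (u v : Tan E x) :
    Bil E x :=
  if h : ∃ J : Fin 3 → EndT E x, IsQuatBasis (Q x) J then
    ∑ i, omega g x (h.choose i) u v • omega g x (h.choose i)
  else 0

set_option synthInstance.maxHeartbeats 400000 in
set_option maxHeartbeats 1000000 in
/-- The defining formula of `Θ` holds for every quaternionic basis. -/
theorem Theta_eq (g : Metric E M) (Q : ∀ x : M, Submodule ℝ (EndT E x)) (x : M)
    (J : Fin 3 → EndT E x) (hJ : IsQuatBasis (Q x) J) (u v : Tan E x) :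
    Theta g Q x u v = ∑ i, omega g x (J i) u v • omega g x (J i) := by
  have hex : ∃ J : Fin 3 → EndT E x, IsQuatBasis (Q x) J := ⟨J, hJ⟩
  rw [Theta, dif_pos hex]
  set J' := hex.choose
  have hJ' : IsQuatBasis (Q x) J' := hex.choose_spec
  rcases subsingleton_or_nontrivial (Tan E x) with hs | hn
  · ext w z
    simp [Subsingleton.elim w 0]
  have anti : ∀ {I : Fin 3 → EndT E x}, IsQuatBasis (Q x) I → ∀ i j,
      (I i).comp (I j) + (I j).comp (I i) =
        (if i = j then (-2 : ℝ) else 0) • ContinuousLinearMap.id ℝ (Tan E x) := by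
    intro I hI i j
    have h0 := hI.mul 0; have h1 := hI.mul 1; have h2 := hI.mul 2
    have r0 := hI.mul_rev 0; have r1 := hI.mul_rev 1; have r2 := hI.mul_rev 2
    simp only [Fin.isValue, Fin.reduceAdd] at h0 h1 h2 r0 r1 r2
    have s0 := hI.sq
    fin_cases i <;> fin_cases j <;>
      simp [h0, h1, h2, r0, r1, r2, s0, neg_smul, two_smul]
  have hmem : ∀ i, ∃ c : Fin 3 → ℝ, ∑ j, c j • J j = J' i := by
    intro i
    have : J' i ∈ Submodule.span ℝ (Set.range J) := by
      rw [hJ.span, ← hJ'.span]; exact Submodule.subset_span ⟨i, rfl⟩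
    exact (Submodule.mem_span_range_iff_exists_fun ℝ).1 this
  choose a ha using hmem
  have key : Matrix.of a * (Matrix.of a).transpose = 1 := by
    ext i k
    have h := anti hJ' i k
    rw [← ha i, ← ha k] at h
    have h2 : (∑ j, a i j • J j).comp (∑ l, a k l • J l) +
        (∑ l, a k l • J l).comp (∑ j, a i j • J j) =
        ((-2 : ℝ) * ∑ j, a i j * a k j) • ContinuousLinearMap.id ℝ (Tan E x) := by
      have h3 : (∑ j, a i j • J j).comp (∑ l, a k l • J l) +
          (∑ l, a k l • J l).comp (∑ j, a i j • J j) =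
          ∑ j, ∑ l, (a i j * a k l) • ((J j).comp (J l) + (J l).comp (J j)) := by
        ext w
        simp [Fin.sum_univ_three, smul_smul]
        module
      rw [h3]
      simp only [anti hJ]
      simp [Fin.sum_univ_three]
      module
    rw [h2] at h
    obtain ⟨w, hw⟩ := exists_ne (0 : Tan E x)
    have h4 := congrArg (fun T : EndT E x => T w) h
    simp only [_root_.smul_apply, ContinuousLinearMap.id_apply] at h4
    have h5 := smul_left_injective ℝ hw h4
    simp only [Matrix.mul_apply, Matrix.transpose_apply, Matrix.of_apply, Matrix.one_apply]
    split_ifs at h5 ⊢ <;> linarith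
  have key2 : (Matrix.of a).transpose * Matrix.of a = 1 := mul_eq_one_comm.1 key
  have orth : ∀ j l, ∑ i, a i j * a i l = if j = l then 1 else 0 := by
    intro j l
    have := congrFun (congrFun key2 j) l
    simpa [Matrix.mul_apply, Matrix.one_apply] using this
  ext w z
  have o00 := orth 0 0; have o01 := orth 0 1; have o02 := orth 0 2
  have o11 := orth 1 1; have o12 := orth 1 2; have o22 := orth 2 2
  simp only [Fin.sum_univ_three, Fin.isValue] at o00 o01 o02 o11 o12 o22
  have hω : ∀ i, ∀ p q : Tan E x, omega g x (J' i) p q = a i 0 * g.inner x (J 0 p) q +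
      a i 1 * g.inner x (J 1 p) q + a i 2 * g.inner x (J 2 p) q := by
    intro i p q
    rw [← ha i]
    simp [omega, Fin.sum_univ_three]
  have hω0 : ∀ i, ∀ p q : Tan E x, omega g x (J i) p q = g.inner x (J i p) q := fun _ _ _ => rfl
  rw [Fin.sum_univ_three, Fin.sum_univ_three]
  simp only [_root_.add_apply, _root_.smul_apply, smul_eq_mul, hω, hω0]
  simp at o00 o01 o02 o11 o12 o22
  generalize g.inner x (J 0 u) v = p0
  generalize g.inner x (J 1 u) v = p1
  generalize g.inner x (J 2 u) v = p2
  generalize g.inner x (J 0 w) z = q0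
  generalize g.inner x (J 1 w) z = q1
  generalize g.inner x (J 2 w) z = q2
  linear_combination (p0 * q0) * o00 + (p0 * q1 + p1 * q0) * o01 + (p0 * q2 + p2 * q0) * o02 +
    (p1 * q1) * o11 + (p1 * q2 + p2 * q1) * o12 + (p2 * q2) * o22

/-- The fundamental `4`-form `Θ^∧ = ∑ᵢ ωᵢ ∧ ωᵢ`, where
`(ω ∧ ω)(a, b, c, d) = 2 (ω(a,b) ω(c,d) - ω(a,c) ω(b,d) + ω(a,d) ω(b,c))`. -/
def fundForm (g : Metric E M) (Q : ∀ x : M, Submodule ℝ (EndT E x)) (x : M)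
    (a b c d : Tan E x) : ℝ :=
  2 * (Theta g Q x a b c d - Theta g Q x a c b d + Theta g Q x a d b c)

/-- `(M, g, Q)` is an almost quaternionic manifold with compatible metric. -/
structure IsAlmostQuaternionic (g : Metric E M) (Q : ∀ x : M, Submodule ℝ (EndT E x)) :
    Prop where
  /-- `Q` has smooth local frames which satisfy the quaternionic relations. -/
  frame : ∀ x : M, ∃ (U : Set M) (J : Fin 3 → ∀ y : M, EndT E y), IsOpen U ∧ x ∈ U ∧
    (∀ i, ContMDiffOn 𝓘(ℝ, E) (𝓘(ℝ, E).prod 𝓘(ℝ, E →L[ℝ] E)) ∞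
      (fun y : M => (⟨y, J i y⟩ : TotalSpace (E →L[ℝ] E) (fun y : M => EndT E y))) U) ∧
    ∀ y ∈ U, IsQuatBasis (Q y) (fun i => J i y)
  /-- The almost complex structures in `Q` are orthogonal. -/
  compat : ∀ (x : M), ∀ J ∈ Q x, J.comp J = -ContinuousLinearMap.id ℝ (Tan E x) →
    ∀ u v : Tan E x, g.inner x (J u) (J v) = g.inner x u v

/-- `(M, g, Q)` is quaternionic Kähler: `∇ Θ^∧ = 0` for the Levi-Civita connection `D` of `g`. -/
structure IsQuaternionicKaehler (g : Metric E M) (D : Conn E M)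
    [D.ContMDiffCovariantDerivative ∞] (Q : ∀ x : M, Submodule ℝ (EndT E x)) : Prop
    extends IsAlmostQuaternionic g Q where
  parallel : ∀ (X Y₁ Y₂ Y₃ Y₄ : VField E M) (x : M),
    deriv₄ X (nabla D X) (fundForm g Q) Y₁ Y₂ Y₃ Y₄ x = 0

/-- `V` is a quaternionic Kähler Killing vector field: `ℒ_V g = 0` and `ℒ_V Θ^∧ = 0`. -/
structure IsQKKilling [FiniteDimensional ℝ E] (g : Metric E M)
    (Q : ∀ x : M, Submodule ℝ (EndT E x)) (V : VField E M) : Prop where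
  killing : ∀ (X Y : VField E M) (x : M),
    dirDeriv V (fun y => g.inner y (X y) (Y y)) x
      - g.inner x (lieBr V X x) (Y x) - g.inner x (X x) (lieBr V Y x) = 0
  lie_fundForm : ∀ (Y₁ Y₂ Y₃ Y₄ : VField E M) (x : M),
    deriv₄ V (lieBr V) (fundForm g Q) Y₁ Y₂ Y₃ Y₄ x = 0

end Quaternionic

/-! ### Homotopy momentum sections in degree one -/

section Momentum

/-- `E`-valued homotopy momentum sections for an `E`-valued (pre-)`1`-plectic form `Ω` and a
Lie algebroid `A`, in terms of the following data on spaces of sections: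
* `𝔛`, `ΓA`, `ΓE`: vector fields, sections of `A`, sections of `E`;
* `nablaE`, `nablaA`: the connections on `E` and on `A`;
* `ρ`, `br`: the anchor and the bracket of `A`;
* `Ω`: the form; `μ`: the section of `A^* ⊗ E`, as a map on sections.

For `n = 1` the formal sum has the single component `μ = μ₀`, of bidegree `(0, 1)`, and the
equation `(d_∇ + ð_℧) μ = ι_ρ¹ Ω - ι_ρ² Ω` has two components:
* bidegree `(1, 1)`: `∇^{A^* ⊗ E} μ = ι_ρ¹ Ω`, where
  `(∇^{A^* ⊗ E}_X μ)(α) = ∇^E_X (μ(α)) - μ(∇^A_X α)` and `(ι_ρ¹ Ω)(α) = ι_{ρ(α)} Ω`;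
* bidegree `(0, 2)`: `ð_℧ μ = - ι_ρ² Ω`, where, the `A`-connection `℧` being `∇^E_{ρ(α)}` in
  form degree `0`,
  `(ð_℧ μ)(α, β) = ∇^E_{ρ(α)} (μ(β)) - ∇^E_{ρ(β)} (μ(α)) - μ([α, β])` and
  `(ι_ρ² Ω)(α, β) = Ω(ρ(α), ρ(β))`. -/
structure IsHomotopyMomentumSection {𝔛 ΓA ΓE : Type*} [AddCommGroup ΓE]
    (nablaE : 𝔛 → ΓE → ΓE) (nablaA : 𝔛 → ΓA → ΓA) (ρ : ΓA → 𝔛) (br : ΓA → ΓA → ΓA)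
    (Ω : 𝔛 → 𝔛 → ΓE) (μ : ΓA → ΓE) : Prop where
  nabla_eq : ∀ (X : 𝔛) (α : ΓA), nablaE X (μ α) - μ (nablaA X α) = Ω (ρ α) X
  eth_eq : ∀ α β : ΓA,
    nablaE (ρ α) (μ β) - nablaE (ρ β) (μ α) - μ (br α β) = -Ω (ρ α) (ρ β)

variable {E : Type*} [NormedAddCommGroup E] [NormedSpace ℝ E] [FiniteDimensional ℝ E]
  {M : Type*} [TopologicalSpace M] [ChartedSpace E M] [IsManifold 𝓘(ℝ, E) ∞ M]

/-- A smooth vector subbundle `K ⊂ TM` whose sections are closed under the Lie bracket, that is,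
a Lie algebroid with the inclusion as its anchor. -/
structure LieSubbundle (E : Type*) [NormedAddCommGroup E] [NormedSpace ℝ E]
    [FiniteDimensional ℝ E] (M : Type*) [TopologicalSpace M] [ChartedSpace E M]
    [IsManifold 𝓘(ℝ, E) ∞ M] where
  fiber : ∀ x : M, Submodule ℝ (Tan E x)
  frame : ∀ x : M, ∃ (U : Set M) (r : ℕ) (s : Fin r → ∀ y : M, Tan E y), IsOpen U ∧ x ∈ U ∧
    (∀ i, ContMDiffOn 𝓘(ℝ, E) (𝓘(ℝ, E).prod 𝓘(ℝ, E)) ∞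
      (fun y : M => (⟨y, s i y⟩ : TotalSpace E (fun y : M => Tan E y))) U) ∧
    ∀ y ∈ U, LinearIndependent ℝ (fun i => s i y) ∧
      Submodule.span ℝ (Set.range fun i => s i y) = fiber y
  bracket_mem : ∀ V W : VField E M, (∀ x, V x ∈ fiber x) → (∀ x, W x ∈ fiber x) →
    ∀ x, lieBr V W x ∈ fiber x

namespace LieSubbundle

/-- The space `Γ(K)` of smooth sections of `K`. -/
def Sec (K : LieSubbundle E M) : Submodule ℝ (VField E M) where
  carrier := {V | ∀ x, V x ∈ K.fiber x}
  add_mem' hV hW x := (K.fiber x).add_mem (hV x) (hW x)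
  zero_mem' x := (K.fiber x).zero_mem
  smul_mem' c _ hV x := (K.fiber x).smul_mem c (hV x)

/-- The anchor: a section of `K`, viewed as a vector field. -/
def anchor (K : LieSubbundle E M) (V : K.Sec) : VField E M := V.1

/-- The bracket of two sections of `K`. -/
def br (K : LieSubbundle E M) (V W : K.Sec) : K.Sec :=
  ⟨lieBr V.1 W.1, K.bracket_mem V.1 W.1 V.2 W.2⟩

/-- The connection `D` on `TM` restricts to a connection on `K`. -/
def IsInvariant (K : LieSubbundle E M) (D : Conn E M) [D.ContMDiffCovariantDerivative ∞] :
    Prop :=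
  ∀ (X : VField E M) (V : K.Sec) (x : M), nabla D X V.1 x ∈ K.fiber x

/-- The restriction of `D` to `K`. -/
def nablaK (K : LieSubbundle E M) {D : Conn E M} [D.ContMDiffCovariantDerivative ∞]
    (hK : K.IsInvariant D) (X : VField E M) (V : K.Sec) : K.Sec :=
  ⟨nabla D X V.1, hK X V⟩

/-- A smooth section of `K^* ⊗ Q`, where `Q` is regarded as a bundle of bilinear forms by
`J ↦ ω_J`. -/
structure QForm (K : LieSubbundle E M) (g : Metric E M)
    (Q : ∀ x : M, Submodule ℝ (EndT E x)) where
  val : ∀ x : M, K.fiber x →ₗ[ℝ] Bil E x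
  mem : ∀ (x : M) (v : K.fiber x), ∃ J ∈ Q x, val x v = omega g x J
  smooth : ∀ V : K.Sec, ContMDiff 𝓘(ℝ, E) (𝓘(ℝ, E).prod 𝓘(ℝ, E →L[ℝ] E →L[ℝ] ℝ)) ∞
    (fun x : M => (⟨x, val x ⟨V.1 x, V.2 x⟩⟩ :
      TotalSpace (E →L[ℝ] E →L[ℝ] ℝ) (fun x : M => Bil E x)))

/-- The section `f_V` of `Q`, for a section `V` of `K`. -/
def QForm.app {K : LieSubbundle E M} {g : Metric E M} {Q : ∀ x : M, Submodule ℝ (EndT E x)}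
    (f : K.QForm g Q) (V : K.Sec) : Tensor₂ E M :=
  Tensor₂.ofField fun x => f.val x ⟨V.1 x, V.2 x⟩

/-- `𝔨` is a Lie algebra of sections of `K`, consisting of quaternionic Kähler Killing vector
fields, which generates `K` (its elements span every fibre of `K`). -/
structure IsKillingGenerator (K : LieSubbundle E M) (g : Metric E M)
    (Q : ∀ x : M, Submodule ℝ (EndT E x)) (𝔨 : Submodule ℝ K.Sec) : Prop where
  killing : ∀ V ∈ 𝔨, IsQKKilling g Q V.1
  bracket : ∀ V ∈ 𝔨, ∀ W ∈ 𝔨, K.br V W ∈ 𝔨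
  generates : ∀ (x : M), ∀ v ∈ K.fiber x, ∃ V ∈ 𝔨, V.1 x = v

end LieSubbundle

/-- The `Q`-valued `2`-form `Θ`, evaluated on two vector fields. -/
def ThetaForm (g : Metric E M) (Q : ∀ x : M, Submodule ℝ (EndT E x)) (X Y : VField E M) :
    Tensor₂ E M :=
  Tensor₂.ofField fun x => Theta g Q x (X x) (Y x)

/-- `f` is a Galicki–Lawson momentum map for the Lie algebra `𝔨` of Killing fields:
`∇ f_V = Θ_V = ι_V Θ` for all `V ∈ 𝔨`. -/
def IsGLMomentumMap {g : Metric E M} (D : Conn E M) [D.ContMDiffCovariantDerivative ∞]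
    {Q : ∀ x : M, Submodule ℝ (EndT E x)} {K : LieSubbundle E M} (𝔨 : Submodule ℝ K.Sec)
    (f : K.QForm g Q) : Prop :=
  ∀ V ∈ 𝔨, ∀ X : VField E M, nablaTensor₂ D X (f.app V) = ThetaForm g Q (K.anchor V) X

end Momentum

end QuatKaehler

end

/-!
Both sides of the equivalence turn out to say that `K = 0`; the content is that the equation
`f_[V,W] = -Θ(V, W)` on `𝔨` already forces this. In the other direction, subtract the momentum
equations of `V` and `W` from the bidegree `(0, 2)` equation.

Suppose `f_[V,W] = -Θ(V, W)` for all `V, W ∈ 𝔨`, and write `A_V = ∇V`, a skew-symmetric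
endomorphism.

* A skew-symmetric endomorphism which annihilates the fundamental form `Θ^∧` normalises `Q`: its
  commutator with `Q ≅ ℝ³` is a cross product `c ↦ c × β`. The same computation, applied to the
  derivative of a local quaternionic frame, turns `∇ Θ^∧ = 0` into `∇ Θ = 0`
  (`IsQuatTriple.exists_cross_of_alternation_eq_zero`, `IsAlmostQuaternionic.exists_rotation`,
  `IsQuaternionicKaehler.deriv₄_Theta`). It applies to every `A_V` and to every curvature
  endomorphism `R(X, Y)`.
* Differentiating the hypothesis, with `∇ f_V = Θ_V` and `∇ Θ = 0`, gives
  `[J, A_W] V = [J, A_V] W` for `J ∈ Q` (`commutator_covDeriv_symm`). If some `β_V` were non-zero at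
  a point, all elements of `𝔨` would be proportional there; but `A_V` takes values in `K`, since `K`
  is `∇`-invariant, so a skew-symmetric `A_V` of rank at most one would vanish, and `β_V` with it.
  Hence `A_V` commutes with `Q` wherever `K ≠ 0` (`IsQuatTriple.rotation_eq_zero`,
  `commute_covDeriv`).
* The antisymmetrised second derivative of `f_V` is `Θ(A_V X, Y) - Θ(A_V Y, X) = 0`, so by the Ricci
  identity `f_V ∈ Q` commutes with the curvature. By the first Bianchi identity a non-zero such
  element exists only in dimension `4` or at zero scalar curvature
  (`IsQuatTriple.scalar_eq_zero_of_commute`,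
  `IsQuaternionicKaehler.eq_zero_of_curvField_annihilates`). Hence `f = 0` (`momentumMap_eq_zero`).
* Then `Θ_V = ∇ f_V = 0`, so `V = 0` for all `V ∈ 𝔨`, and `K = 0` (`fiber_eq_bot`).
-/

noncomputable section

namespace QuatKaehler

/-! ### Quaternionic linear algebra -/

section LinearAlgebra

open Matrix

variable {V : Type*} [AddCommGroup V] [Module ℝ V] {ι : Type*} [Fintype ι]

/-- A pair of families which are dual to each other for the bilinear form `g`: every vector is
recovered from its products with one family as a combination of the other. Contractions
`∑ e, h e e` over an orthonormal basis become `∑ k, h (b k) (b' k)`. -/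
structure IsDualPair (g : V →ₗ[ℝ] V →ₗ[ℝ] ℝ) (b b' : ι → V) : Prop where
  symm : ∀ u v, g u v = g v u
  sum_left : ∀ u, ∑ k, g u (b k) • b' k = u
  sum_right : ∀ u, ∑ k, g u (b' k) • b k = u

namespace IsDualPair

variable {g : V →ₗ[ℝ] V →ₗ[ℝ] ℝ} {b b' : ι → V}

theorem swap (h : IsDualPair g b b') : IsDualPair g b' b := ⟨h.symm, h.sum_right, h.sum_left⟩

theorem sum_smul_map (h : IsDualPair g b b') {W : Type*} [AddCommGroup W] [Module ℝ W]
    (S : V →ₗ[ℝ] W) (u : V) : ∑ k, g u (b k) • S (b' k) = S u := by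
  conv_rhs => rw [← h.sum_left u]
  simp [map_sum]

theorem eq_zero (h : IsDualPair g b b') {u : V} (hu : ∀ v, g u v = 0) : u = 0 := by
  rw [← h.sum_left u]; simp [hu]

theorem sum_symm (hb : IsDualPair g b b') (h : V →ₗ[ℝ] V →ₗ[ℝ] ℝ) :
    ∑ k, h (b' k) (b k) = ∑ k, h (b k) (b' k) := by
  have h1 : ∀ k, h (b' k) (b k) = ∑ l, g (b' k) (b' l) * h (b l) (b k) := fun k => by
    have := hb.swap.sum_smul_map (h.flip (b k)) (b' k)
    simpa using this.symm
  have h2 : ∀ k, h (b k) (b' k) = ∑ l, g (b' k) (b' l) * h (b k) (b l) := fun k => by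
    have := hb.swap.sum_smul_map (h (b k)) (b' k)
    simpa using this.symm
  simp only [h1, h2]
  rw [Finset.sum_comm]
  refine Finset.sum_congr rfl fun k _ => Finset.sum_congr rfl fun l _ => ?_
  rw [hb.symm]

/-- Orthogonal complex structures map dual pairs to dual pairs. -/
theorem sum_map_map (hb : IsDualPair g b b') {J : V →ₗ[ℝ] V} (hJ : ∀ v, J (J v) = -v)
    (hskew : ∀ u v, g (J u) v = -g u (J v)) (h : V →ₗ[ℝ] V →ₗ[ℝ] ℝ) :
    ∑ k, h (J (b k)) (J (b' k)) = ∑ k, h (b k) (b' k) := by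
  have h1 : ∀ k, h (J (b k)) (J (b' k)) = ∑ l, g (J (b k)) (b' l) * h (b l) (J (b' k)) :=
    fun k => by
      have := hb.swap.sum_smul_map (h.flip (J (b' k))) (J (b k))
      simpa using this.symm
  simp only [h1]
  rw [Finset.sum_comm]
  refine Finset.sum_congr rfl fun l _ => ?_
  have := hb.sum_smul_map (h (b l) ∘ₗ J) (-J (b' l))
  simp only [LinearMap.comp_apply, map_neg, hJ, neg_neg, smul_eq_mul] at this
  rw [← this]
  refine Finset.sum_congr rfl fun k _ => ?_
  rw [hskew, LinearMap.neg_apply, hb.symm (b k)]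

theorem sum_skew (hb : IsDualPair g b b') {S : V →ₗ[ℝ] V}
    (hskew : ∀ u v, g (S u) v = -g u (S v)) : ∑ k, g (S (b k)) (b' k) = 0 := by
  have h := hb.sum_symm (g ∘ₗ S)
  simp only [LinearMap.comp_apply] at h
  have h2 : ∑ k, g (S (b' k)) (b k) = -∑ k, g (S (b k)) (b' k) := by
    rw [← Finset.sum_neg_distrib]
    exact Finset.sum_congr rfl fun k _ => by rw [hskew, hb.symm]
  linarith

theorem sum_comp_comm (hb : IsDualPair g b b') (S T : V →ₗ[ℝ] V) :
    ∑ k, g (S (T (b k))) (b' k) = ∑ k, g (T (S (b k))) (b' k) := by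
  have h1 : ∀ S T : V →ₗ[ℝ] V, ∀ k, g (S (T (b k))) (b' k) =
      ∑ l, g (T (b k)) (b' l) * g (S (b l)) (b' k) := fun S T k => by
    have := hb.swap.sum_smul_map (g.flip (b' k) ∘ₗ S) (T (b k))
    simpa using this.symm
  simp only [h1 S T, h1 T S]
  rw [Finset.sum_comm]
  exact Finset.sum_congr rfl fun k _ => Finset.sum_congr rfl fun l _ => mul_comm _ _

end IsDualPair

/-- A quaternionic basis `J₁, J₂, J₃` of skew-symmetric endomorphisms, with indices modulo `3`. -/
structure IsQuatTriple (g : V →ₗ[ℝ] V →ₗ[ℝ] ℝ) (J : Fin 3 → V →ₗ[ℝ] V) : Prop where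
  sq : ∀ i v, J i (J i v) = -v
  mul : ∀ i v, J i (J (i + 1) v) = J (i + 2) v
  mul_rev : ∀ i v, J (i + 1) (J i v) = -J (i + 2) v
  skew : ∀ i u v, g (J i u) v = -g u (J i v)

/-- The imaginary quaternion `c₁ J₁ + c₂ J₂ + c₃ J₃`. -/
def imag (J : Fin 3 → V →ₗ[ℝ] V) (c : Fin 3 → ℝ) : V →ₗ[ℝ] V := ∑ i, c i • J i

theorem imag_apply (J : Fin 3 → V →ₗ[ℝ] V) (c : Fin 3 → ℝ) (v : V) :
    imag J c v = c 0 • J 0 v + c 1 • J 1 v + c 2 • J 2 v := by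
  simp [imag, Fin.sum_univ_three]

theorem sum_fin_three_cyclic {A : Type*} [AddCommGroup A] (F : Fin 3 → A) (j : Fin 3) :
    ∑ i, F i = F j + F (j + 1) + F (j + 2) := by
  fin_cases j <;> simp [Fin.sum_univ_three] <;> abel

theorem eq_smul_of_cross_eq_zero {a b : Fin 3 → ℝ} (ha : a ≠ 0) (h : a ⨯₃ b = 0) :
    ∃ t : ℝ, b = t • a := by
  have h0 := congrFun h 0
  have h1 := congrFun h 1
  have h2 := congrFun h 2
  simp only [cross_apply, cons_val_zero, cons_val_one, cons_val, Pi.zero_apply] at h0 h1 h2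
  have hs : a ⬝ᵥ a ≠ 0 := fun h => ha (dotProduct_self_eq_zero.1 h)
  refine ⟨(a ⬝ᵥ b) / (a ⬝ᵥ a), ?_⟩
  ext i
  rw [Pi.smul_apply, smul_eq_mul, div_mul_eq_mul_div, eq_div_iff hs]
  simp only [vec3_dotProduct]
  fin_cases i <;> simp
  · linear_combination a 1 * h2 * (-1) + a 2 * h1
  · linear_combination a 0 * h2 - a 2 * h0
  · linear_combination a 1 * h0 - a 0 * h1

theorem cross_eq_zero_of_forall {a : Fin 3 → ℝ} (h : ∀ c : Fin 3 → ℝ, c ⨯₃ a = 0) : a = 0 := by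
  have h0 := h ![1, 0, 0]
  have h1 := h ![0, 1, 0]
  have e1 := congrFun h0 1
  have e2 := congrFun h0 2
  have e0 := congrFun h1 2
  simp [cross_apply] at e0 e1 e2
  ext i
  fin_cases i <;> simp [*]

theorem exists_unit_orthogonal (c : Fin 3 → ℝ) : ∃ d : Fin 3 → ℝ, d ⬝ᵥ d = 1 ∧ c ⬝ᵥ d = 0 := by
  have main : ∃ d : Fin 3 → ℝ, d ≠ 0 ∧ c ⬝ᵥ d = 0 := by
    by_cases h : c 0 = 0
    · exact ⟨![1, 0, 0], fun h => by simpa using congrFun h 0, by rw [vec3_dotProduct]; simp [h]⟩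
    · exact ⟨![c 1, -c 0, 0], fun h' => h (by simpa using congrFun h' 1),
        by rw [vec3_dotProduct]; simp; ring⟩
  obtain ⟨d, hd, hcd⟩ := main
  have hpos : 0 < d ⬝ᵥ d := lt_of_le_of_ne (Finset.sum_nonneg fun i _ => mul_self_nonneg (d i))
    fun h => hd (dotProduct_self_eq_zero.1 h.symm)
  refine ⟨(√(d ⬝ᵥ d))⁻¹ • d, ?_, by simp [hcd]⟩
  have := Real.mul_self_sqrt hpos.le
  have hne : √(d ⬝ᵥ d) ≠ 0 := (Real.sqrt_pos.2 hpos).ne'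
  simp only [smul_dotProduct, dotProduct_smul, smul_eq_mul]
  field_simp
  linarith

namespace IsQuatTriple

variable {g : V →ₗ[ℝ] V →ₗ[ℝ] ℝ} {J : Fin 3 → V →ₗ[ℝ] V}

theorem imag_imag (hJ : IsQuatTriple g J) (c d : Fin 3 → ℝ) (v : V) :
    imag J c (imag J d v) = -(c ⬝ᵥ d) • v + imag J (c ⨯₃ d) v := by
  have m0 := hJ.mul 0 v; have m1 := hJ.mul 1 v; have m2 := hJ.mul 2 v
  have r0 := hJ.mul_rev 0 v; have r1 := hJ.mul_rev 1 v; have r2 := hJ.mul_rev 2 v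
  simp only [Fin.isValue, Fin.reduceAdd] at m0 m1 m2 r0 r1 r2
  simp only [imag_apply, map_add, map_smul, hJ.sq, m0, m1, m2, r0, r1, r2, cross_apply,
    vec3_dotProduct, cons_val_zero, cons_val_one, cons_val]
  module

theorem imag_skew (hJ : IsQuatTriple g J) (c : Fin 3 → ℝ) (u v : V) :
    g (imag J c u) v = -g u (imag J c v) := by
  simp only [imag_apply, map_add, map_smul, LinearMap.add_apply, LinearMap.smul_apply, hJ.skew,
    smul_eq_mul]
  ring

theorem eq_zero_of_imag_apply (hJ : IsQuatTriple g J) {c : Fin 3 → ℝ} {v : V} (hv : v ≠ 0)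
    (h : imag J c v = 0) : c = 0 := by
  have := hJ.imag_imag c c v
  rw [h, map_zero, cross_self] at this
  have h2 : (c ⬝ᵥ c) • v = 0 := by simpa [imag_apply] using this
  exact dotProduct_self_eq_zero.1 ((smul_eq_zero.1 h2).resolve_right hv)

end IsQuatTriple

/-- Infinitesimal deformations `C` of a quaternionic triple `J` under which the fundamental
`4`-form is invariant are rotations of the triple. Contracting the invariance equation with `J j`
gives `n C_j + ∑ᵢ ⟨C_i, J_j⟩ J_i + 2 ∑ᵢ (C_i J_j J_i + J_i J_j C_i) = 0`, and the last sum vanishes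
by the linearised multiplication table. -/
theorem IsQuatTriple.exists_cross_of_alternation_eq_zero [Nontrivial V]
    {g : V →ₗ[ℝ] V →ₗ[ℝ] ℝ} {J : Fin 3 → V →ₗ[ℝ] V} (hJ : IsQuatTriple g J)
    {b b' : ι → V} (hb : IsDualPair g b b') (hn : ∑ k, g (b k) (b' k) ≠ 0)
    (C : Fin 3 → V →ₗ[ℝ] V) (hC : ∀ i u v, g (C i u) v = -g u (C i v))
    (hmul : ∀ i v, C (i + 2) v = C i (J (i + 1) v) + J i (C (i + 1) v))
    (hrev : ∀ i v, -C (i + 2) v = C (i + 1) (J i v) + J (i + 1) (C i v))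
    (halt : ∀ a b c d, ∑ i, (g (C i a) b * g (J i c) d + g (J i a) b * g (C i c) d)
      - ∑ i, (g (C i a) c * g (J i b) d + g (J i a) c * g (C i b) d)
      + ∑ i, (g (C i a) d * g (J i b) c + g (J i a) d * g (C i b) c) = 0) :
    ∃ β : Fin 3 → ℝ, ∀ (c : Fin 3 → ℝ) (v : V), ∑ i, c i • C i v = imag J (c ⨯₃ β) v := by
  set n := ∑ k, g (b k) (b' k) with hn_def
  have hvec : ∀ a b c, ∑ i, (g (C i a) b • J i c + g (J i a) b • C i c
      - g (C i a) c • J i b - g (J i a) c • C i b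
      + g (J i b) c • C i a + g (C i b) c • J i a) = 0 := by
    intro a b c
    refine hb.eq_zero fun d => ?_
    rw [← halt a b c d, ← Finset.sum_sub_distrib, ← Finset.sum_add_distrib, map_sum,
      LinearMap.sum_apply]
    refine Finset.sum_congr rfl fun i _ => ?_
    simp only [map_add, map_sub, map_smul, LinearMap.add_apply, LinearMap.sub_apply,
      LinearMap.smul_apply, smul_eq_mul]
    ring
  let s : Fin 3 → Fin 3 → ℝ := fun i j => ∑ k, g (C i (b k)) (J j (b' k))
  have hJJ : ∀ i j, ∑ k, g (J i (b k)) (J j (b' k)) = if i = j then n else 0 := by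
    have hoff : ∀ i, ∑ k, g (J i (b k)) (b' k) = 0 := fun i => hb.sum_skew (hJ.skew i)
    have h1 : ∀ i j k, g (J i (b k)) (J j (b' k)) = -g (J j (J i (b k))) (b' k) :=
      fun i j k => by rw [hJ.skew j]; simp
    intro i j
    simp only [h1, Finset.sum_neg_distrib]
    obtain rfl | rfl | rfl : j = i ∨ i = j + 1 ∨ j = i + 1 := by revert i j; decide
    · simp [hJ.sq, hn_def]
    · simp [hJ.mul, hoff]
    · simp [hJ.mul_rev, hoff]
  have hcontr : ∀ j c, n • C j c + ∑ i, s i j • J i c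
      + (2 : ℝ) • ∑ i, (J i (J j (C i c)) + C i (J j (J i c))) = 0 := by
    intro j c
    have h0 : ∑ k, ∑ i, (g (C i (b k)) (J j (b' k)) • J i c + g (J i (b k)) (J j (b' k)) • C i c
        - g (C i (b k)) c • J i (J j (b' k)) - g (J i (b k)) c • C i (J j (b' k))
        + g (J i (J j (b' k))) c • C i (b k) + g (C i (J j (b' k))) c • J i (b k)) = 0 :=
      Finset.sum_eq_zero fun k _ => hvec _ _ _
    rw [Finset.sum_comm] at h0
    have h3 : ∀ i, ∑ k, g (C i (b k)) c • J i (J j (b' k)) = -J i (J j (C i c)) := fun i => by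
      have := hb.sum_smul_map (J i ∘ₗ J j) (C i c)
      simp only [LinearMap.comp_apply] at this
      rw [← this, ← Finset.sum_neg_distrib]
      refine Finset.sum_congr rfl fun k _ => ?_
      rw [hC, hb.symm, neg_smul]
    have h4 : ∀ i, ∑ k, g (J i (b k)) c • C i (J j (b' k)) = -C i (J j (J i c)) := fun i => by
      have := hb.sum_smul_map (C i ∘ₗ J j) (J i c)
      simp only [LinearMap.comp_apply] at this
      rw [← this, ← Finset.sum_neg_distrib]
      refine Finset.sum_congr rfl fun k _ => ?_
      rw [hJ.skew, hb.symm, neg_smul]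
    have h5 : ∀ i, ∑ k, g (J i (J j (b' k))) c • C i (b k) = C i (J j (J i c)) := fun i => by
      have := hb.swap.sum_smul_map (C i) (J j (J i c))
      rw [← this]
      refine Finset.sum_congr rfl fun k _ => ?_
      rw [hJ.skew, hJ.skew, neg_neg, hb.symm]
    have h6 : ∀ i, ∑ k, g (C i (J j (b' k))) c • J i (b k) = J i (J j (C i c)) := fun i => by
      have := hb.swap.sum_smul_map (J i) (J j (C i c))
      rw [← this]
      refine Finset.sum_congr rfl fun k _ => ?_
      rw [hC, hJ.skew, neg_neg, hb.symm]
    have h2 : ∑ i, (∑ k, g (J i (b k)) (J j (b' k))) • C i c = n • C j c := by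
      simp [hJJ, ite_smul]
    rw [← h0, ← h2, Finset.smul_sum, ← Finset.sum_add_distrib, ← Finset.sum_add_distrib]
    refine Finset.sum_congr rfl fun i _ => ?_
    simp only [Finset.sum_add_distrib, Finset.sum_sub_distrib, ← Finset.sum_smul, h3, h4, h5, h6]
    simp only [s]
    module
  have hzero : ∀ j c, ∑ i, (J i (J j (C i c)) + C i (J j (J i c))) = 0 := by
    intro j c
    have e1 : ∀ k : Fin 3, k + 1 + 2 = k := by decide
    have e2 : ∀ k : Fin 3, k + 2 + 1 = k := by decide
    have e3 : ∀ k : Fin 3, k + 1 + 1 = k + 2 := by decide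
    have e4 : ∀ k : Fin 3, k + 2 + 2 = k + 1 := by decide
    have a1 := hmul (j + 1) c
    have a2 := hrev (j + 1) c
    have m1 := fun v => hJ.mul_rev j v
    have m2 := fun v => hJ.mul (j + 2) v
    have m3 := fun v => hJ.mul j v
    have m4 := fun v => hJ.mul_rev (j + 2) v
    simp only [e1, e2, e3, e4] at a1 a2 m1 m2 m3 m4
    rw [sum_fin_three_cyclic _ j, hJ.sq, hJ.sq, m1, m2, m3, m4, map_neg, map_neg]
    have : (2 : ℝ) • C j c = (C (j + 1) (J (j + 2) c) + J (j + 1) (C (j + 2) c))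
        - (C (j + 2) (J (j + 1) c) + J (j + 2) (C (j + 1) c)) := by
      rw [← a1, ← a2]; module
    rw [← neg_eq_zero]
    refine Eq.trans ?_ (sub_eq_zero.2 this)
    module
  -- The coefficient matrix of `C` in terms of `J`.
  let t : Fin 3 → Fin 3 → ℝ := fun j i => -(n⁻¹ * s i j)
  have hCt : ∀ j v, C j v = imag J (t j) v := by
    intro j v
    have h := hcontr j v
    rw [hzero, smul_zero, add_zero] at h
    have h2 : C j v = n⁻¹ • (n • C j v) := by rw [smul_smul, inv_mul_cancel₀ hn, one_smul]
    rw [h2, eq_neg_of_add_eq_zero_left h, imag_apply, Fin.sum_univ_three]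
    simp only [t]
    module
  obtain ⟨w, hw⟩ := exists_ne (0 : V)
  -- Linearise `J_{i+2} = J_i J_{i+1}`: the real part makes the matrix skew-symmetric off the
  -- diagonal, and the imaginary part kills the diagonal.
  have himag : ∀ i v, J i v = imag J (Pi.single i 1) v := by
    intro i v
    fin_cases i <;> simp [imag_apply]
  have hrel : ∀ i, t (i + 2) = t i ⨯₃ Pi.single (i + 1) 1 + Pi.single i 1 ⨯₃ t (i + 1) ∧
      t i ⬝ᵥ Pi.single (i + 1) 1 + Pi.single i 1 ⬝ᵥ t (i + 1) = 0 := by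
    intro i
    have key : ∀ (c : Fin 3 → ℝ) (r : ℝ), (∀ v, imag J c v = r • v) → c = 0 ∧ r = 0 := by
      intro c r h
      have h2 := hJ.imag_imag c c w
      rw [h w, map_smul, h w, cross_self] at h2
      have h3 : (r * r + c ⬝ᵥ c) • w = 0 := by
        rw [add_smul, mul_smul, h2]
        simp [imag_apply]
      have h4 := (smul_eq_zero.1 h3).resolve_right hw
      have h5 : 0 ≤ c ⬝ᵥ c := Finset.sum_nonneg fun i _ => mul_self_nonneg (c i)
      have h6 : c ⬝ᵥ c = 0 := by nlinarith [mul_self_nonneg r]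
      exact ⟨dotProduct_self_eq_zero.1 h6, by nlinarith [mul_self_nonneg r]⟩
    have h := key (t (i + 2) - (t i ⨯₃ Pi.single (i + 1) 1 + Pi.single i 1 ⨯₃ t (i + 1)))
      (-(t i ⬝ᵥ Pi.single (i + 1) 1 + Pi.single i 1 ⬝ᵥ t (i + 1))) ?_
    · exact ⟨sub_eq_zero.1 h.1, neg_eq_zero.1 h.2⟩
    · intro v
      have h1 := hmul i v
      rw [hCt, hCt, hCt (i + 1), himag (i + 1) v, himag i, hJ.imag_imag, hJ.imag_imag] at h1
      have h2 : ∀ c d : Fin 3 → ℝ, imag J (c - d) v = imag J c v - imag J d v := by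
        intro c d; simp only [imag_apply, Pi.sub_apply]; module
      have h3 : ∀ c d : Fin 3 → ℝ, imag J (c + d) v = imag J c v + imag J d v := by
        intro c d; simp only [imag_apply, Pi.add_apply]; module
      rw [h2, h3, h1]
      module
  have r0 := hrel 0
  have r1 := hrel 1
  have r2 := hrel 2
  simp only [Fin.isValue, Fin.reduceAdd] at r0 r1 r2
  refine ⟨![-t 1 2, -t 2 0, -t 0 1], fun c v => ?_⟩
  obtain ⟨r0, s0⟩ := r0
  obtain ⟨r1, s1⟩ := r1
  obtain ⟨r2, s2⟩ := r2
  have d0 := congrFun r0 2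
  have d1 := congrFun r1 0
  have d2 := congrFun r2 1
  simp [cross_apply] at s0 s1 s2 d0 d1 d2
  have z0 : t 0 0 = 0 := by linarith
  have z1 : t 1 1 = 0 := by linarith
  have z2 : t 2 2 = 0 := by linarith
  have y0 : t 1 0 = -t 0 1 := by linarith
  have y1 : t 2 1 = -t 1 2 := by linarith
  have y2 : t 0 2 = -t 2 0 := by linarith
  simp only [Fin.sum_univ_three, hCt, imag_apply, cross_apply, cons_val_zero, cons_val_one,
    cons_val, z0, z1, z2, y0, y1, y2]
  module

/-- A curvature-like tensor `R` which commutes with the complex structure `I` of a quaternionic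
triple `I, K, I K` and preserves the span of the triple has vanishing scalar curvature, unless the
dimension is `4`. Put `τ(u, v) = tr (I R(u, v))`, so that `[R(u, v), K] = -(2/n) τ(u, v) I K`.
Contracting the first Bianchi identity with `I` gives `t = 2 s`, where `s` is the scalar curvature
and `t` the contraction of `τ` with `I`; contracting it with `K` gives `0 = 2 s - (4/n) t`. -/
theorem IsDualPair.scalar_eq_zero_of_commute {g : V →ₗ[ℝ] V →ₗ[ℝ] ℝ} {b b' : ι → V}
    (hb : IsDualPair g b b') (hn0 : ∑ k, g (b k) (b' k) ≠ 0) (hn4 : ∑ k, g (b k) (b' k) ≠ 4)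
    (R : V →ₗ[ℝ] V →ₗ[ℝ] V →ₗ[ℝ] V) (hanti : ∀ u v w, R u v w = -R v u w)
    (hbianchi : ∀ u v w, R u v w + R v w u + R w u v = 0)
    (I K : V →ₗ[ℝ] V) (hI : ∀ v, I (I v) = -v) (hK : ∀ v, K (K v) = -v)
    (hIK : ∀ v, I (K v) = -K (I v))
    (hIs : ∀ u v, g (I u) v = -g u (I v)) (hKs : ∀ u v, g (K u) v = -g u (K v))
    (hRI : ∀ u v w, R u v (I w) = I (R u v w))
    (hRK : ∀ u v, ∃ c : ℝ, ∀ w, R u v (K w) - K (R u v w) = c • I (K w)) :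
    ∑ j, ∑ k, g (R (b k) (b j) (b' j)) (b' k) = 0 := by
  set n := ∑ k, g (b k) (b' k) with hn_def
  have hKI : ∀ v, K (I v) = -I (K v) := fun v => by rw [hIK, neg_neg]
  let Ric : V →ₗ[ℝ] V →ₗ[ℝ] ℝ := LinearMap.mk₂ ℝ (fun v w => ∑ k, g (R (b k) v w) (b' k))
    (by simp [Finset.sum_add_distrib]) (by simp [Finset.mul_sum])
    (by simp [Finset.sum_add_distrib]) (by simp [Finset.mul_sum])
  let τ : V →ₗ[ℝ] V →ₗ[ℝ] ℝ := LinearMap.mk₂ ℝ (fun u v => ∑ k, g (I (R u v (b k))) (b' k))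
    (by simp [Finset.sum_add_distrib]) (by simp [Finset.mul_sum])
    (by simp [Finset.sum_add_distrib]) (by simp [Finset.mul_sum])
  have hRic : ∀ v w, ∑ k, g (R (b k) v w) (b' k) = Ric v w := fun _ _ => rfl
  have hτ : ∀ u v, ∑ k, g (I (R u v (b k))) (b' k) = τ u v := fun _ _ => rfl
  -- `[R(u, v), K] = -(2/n) τ(u, v) I K`: take the trace against `I K`.
  have hRK' : ∀ u v w, K (R u v w) = R u v (K w) + (2 / n * τ u v) • I (K w) := by
    intro u v
    obtain ⟨c, hc⟩ := hRK u v
    have h1 : ∑ k, g (I (K (R u v (K (b k)) - K (R u v (b k))))) (b' k) = -(c * n) := by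
      simp only [hc, map_smul, LinearMap.smul_apply, smul_eq_mul]
      rw [← Finset.mul_sum, ← mul_neg, hn_def, ← Finset.sum_neg_distrib]
      congr 1
      refine Finset.sum_congr rfl fun k _ => ?_
      rw [hKI, map_neg, hI, hK]; simp
    have h2 : ∑ k, g (I (K (R u v (K (b k))))) (b' k) = τ u v := by
      have := hb.sum_comp_comm (I ∘ₗ K ∘ₗ R u v) K
      simp only [LinearMap.comp_apply] at this
      rw [this, ← hτ]
      refine Finset.sum_congr rfl fun k _ => ?_
      rw [hKI, hK]; simp
    have h3 : ∑ k, g (I (K (K (R u v (b k))))) (b' k) = -τ u v := by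
      rw [← hτ, ← Finset.sum_neg_distrib]
      refine Finset.sum_congr rfl fun k _ => ?_
      rw [hK, map_neg, map_neg, LinearMap.neg_apply]
    simp only [map_sub, LinearMap.sub_apply, Finset.sum_sub_distrib, h2, h3] at h1
    have hc' : 2 / n * τ u v = -c := by
      field_simp
      linarith
    intro w
    rw [hc', neg_smul, ← hc]
    abel
  have htrK : ∀ u v, ∑ k, g (K (R u v (b k))) (b' k) = 0 := by
    intro u v
    have h1 := hb.sum_comp_comm (K ∘ₗ R u v ∘ₗ I) I
    simp only [LinearMap.comp_apply, hI, map_neg, LinearMap.neg_apply,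
      Finset.sum_neg_distrib, hRI, hIK] at h1
    linarith
  have hbi : ∀ S : V →ₗ[ℝ] V, ∀ u v, ∑ k, g (S (R u v (b k))) (b' k) =
      ∑ k, g (S (R u (b k) v)) (b' k) - ∑ k, g (S (R v (b k) u)) (b' k) := by
    intro S u v
    rw [← Finset.sum_sub_distrib]
    refine Finset.sum_congr rfl fun k _ => ?_
    have h1 := hbianchi u v (b k)
    have h2 := hanti (b k) u v
    have h3 : R u v (b k) = R u (b k) v - R v (b k) u := by
      rw [h2] at h1
      rw [← sub_eq_zero]
      refine Eq.trans ?_ h1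
      abel
    rw [h3]; simp
  have hTI : ∀ u v, ∑ k, g (I (R u (b k) v)) (b' k) = -Ric u (I v) := by
    intro u v
    rw [← hRic, ← Finset.sum_neg_distrib]
    refine Finset.sum_congr rfl fun k _ => ?_
    rw [← hRI, hanti]; simp
  have hTK : ∀ u v, ∑ k, g (K (R u (b k) v)) (b' k) = -Ric u (K v) + 2 / n * τ u (I (K v)) := by
    intro u v
    have h1 : ∑ k, g (I (K v)) (b' k) * τ u (b k) = τ u (I (K v)) := by
      simpa using hb.swap.sum_smul_map (τ u) (I (K v))
    rw [← hRic, ← h1, ← Finset.sum_neg_distrib, Finset.mul_sum, ← Finset.sum_add_distrib]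
    refine Finset.sum_congr rfl fun k _ => ?_
    rw [hRK', hanti u (b k) (K v)]
    simp only [map_add, map_smul, map_neg, LinearMap.add_apply, LinearMap.smul_apply,
      LinearMap.neg_apply, smul_eq_mul]
    ring
  set s := ∑ j, Ric (b j) (b' j) with hs
  set t := ∑ j, τ (b j) (I (b' j)) with ht
  have hts : t = 2 * s := by
    have h1 : ∀ j, τ (b j) (I (b' j)) = Ric (b j) (b' j) + Ric.flip (I (b j)) (I (b' j)) := by
      intro j
      rw [← hτ, hbi, hTI, hTI, hI]
      simp
    rw [ht, Finset.sum_congr rfl fun j _ => h1 j, Finset.sum_add_distrib,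
      hb.sum_map_map hI hIs, ← hs]
    have h2 := hb.sum_symm Ric
    simp only [LinearMap.flip_apply]
    rw [h2, ← hs]; ring
  have hK0 : 0 = 2 * s - 4 / n * t := by
    have h1 : ∀ j, 0 = Ric (b j) (b' j) - 2 / n * τ (b j) (I (b' j))
        + Ric.flip (K (b j)) (K (b' j)) - 2 / n * (τ.flip ∘ₗ I) (K (b j)) (K (b' j)) := by
      intro j
      have := htrK (b j) (K (b' j))
      rw [hbi, hTK, hTK, hK] at this
      rw [← this]
      simp
      ring
    have h2 := Finset.sum_congr rfl fun j (_ : j ∈ Finset.univ) => h1 j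
    rw [Finset.sum_const_zero, Finset.sum_sub_distrib, Finset.sum_add_distrib,
      Finset.sum_sub_distrib, ← Finset.mul_sum, ← Finset.mul_sum, hb.sum_map_map hK hKs,
      hb.sum_map_map hK hKs, ← hs, ← ht] at h2
    have h3 := hb.sum_symm Ric
    have h4 := hb.sum_symm (τ.flip ∘ₗ I).flip
    simp only [LinearMap.flip_apply, LinearMap.comp_apply] at h2 h3 h4
    rw [h3, ← hs] at h2
    rw [h4, ← ht] at h2
    rw [h2]; ring
  change s = 0
  rw [hts] at hK0
  have h6 : s * (n - 4) = 0 := by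
    field_simp at hK0
    linarith
  exact (mul_eq_zero.1 h6).resolve_right (sub_ne_zero.2 hn4)

/-- Vectors `ev l` with skew-symmetric endomorphisms `A l`, acting on the quaternionic triple as
rotations `c ↦ c × β`, and with values in the span of the vectors. If `[J, A l] (ev l')` is
symmetric in `l, l'`, then every rotation is trivial: otherwise the rotation vectors are
proportional, hence so are the vectors `ev l`, and a skew-symmetric endomorphism of rank at most
one vanishes. -/
theorem IsQuatTriple.rotation_eq_zero {g : V →ₗ[ℝ] V →ₗ[ℝ] ℝ} {J : Fin 3 → V →ₗ[ℝ] V}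
    (hJ : IsQuatTriple g J) (hpos : ∀ v, v ≠ 0 → 0 < g v v)
    {L : Type*} (ev : L → V) (A : L → V →ₗ[ℝ] V) (β : L → Fin 3 → ℝ)
    (hA : ∀ l u v, g (A l u) v = -g u (A l v)) (hrange : ∀ l u, ∃ l', ev l' = A l u)
    (hβ : ∀ l c v, imag J c (A l v) - A l (imag J c v) = imag J (c ⨯₃ β l) v)
    (hcomm : ∀ l l' c, imag J (c ⨯₃ β l) (ev l') = imag J (c ⨯₃ β l') (ev l))
    (hne : ∃ l, ev l ≠ 0) (l : L) : β l = 0 := by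
  obtain ⟨l₀, hl₀⟩ := hne
  by_contra hl
  have hv : ev l ≠ 0 := fun h => hl <| cross_eq_zero_of_forall fun c =>
    hJ.eq_zero_of_imag_apply hl₀ (by rw [hcomm, h, map_zero])
  obtain ⟨c, hc⟩ : ∃ c : Fin 3 → ℝ, c ⨯₃ β l ≠ 0 := by
    by_contra! h
    exact hl (cross_eq_zero_of_forall h)
  have hprop : ∀ l', ∃ t : ℝ, ev l' = t • ev l := by
    intro l'
    have h1 : β l ⨯₃ β l' = 0 := by
      refine hJ.eq_zero_of_imag_apply hv ?_
      rw [← hcomm, cross_self]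
      simp [imag_apply]
    obtain ⟨t, ht⟩ := eq_smul_of_cross_eq_zero hl h1
    refine ⟨t, ?_⟩
    by_contra hne
    refine hc (hJ.eq_zero_of_imag_apply (sub_ne_zero.2 hne) ?_)
    rw [map_sub, hcomm l l', ht, map_smul, map_smul]
    simp only [imag_apply, Pi.smul_apply, smul_eq_mul]
    module
  have hA0 : ∀ u, A l u = 0 := by
    have h1 : ∀ u, ∃ t : ℝ, A l u = t • ev l := fun u => by
      obtain ⟨l', hl'⟩ := hrange l u
      rw [← hl']; exact hprop l'
    have hp := hpos _ hv
    obtain ⟨t, ht⟩ := h1 (ev l)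
    have h2 := hA l (ev l) (ev l)
    rw [ht, map_smul, LinearMap.smul_apply, map_smul, smul_eq_mul] at h2
    have ht0 : t = 0 := by nlinarith
    intro u
    obtain ⟨r, hr⟩ := h1 u
    have h3 := hA l u (ev l)
    rw [ht, ht0, hr, zero_smul, map_zero, neg_zero, map_smul, LinearMap.smul_apply,
      smul_eq_mul] at h3
    rw [hr, (mul_eq_zero.1 h3).resolve_right hp.ne', zero_smul]
  refine hc (hJ.eq_zero_of_imag_apply hv ?_)
  rw [← hβ, hA0, hA0]
  simp

/-- A curvature-like tensor which normalises a quaternionic triple and annihilates a nonzero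
element of its span has vanishing scalar curvature, unless the dimension is `4`. -/
theorem IsQuatTriple.scalar_eq_zero_of_commute {g : V →ₗ[ℝ] V →ₗ[ℝ] ℝ} {J : Fin 3 → V →ₗ[ℝ] V}
    (hJ : IsQuatTriple g J) {b b' : ι → V} [Nontrivial V]
    (hb : IsDualPair g b b') (hn0 : ∑ k, g (b k) (b' k) ≠ 0) (hn4 : ∑ k, g (b k) (b' k) ≠ 4)
    (R : V →ₗ[ℝ] V →ₗ[ℝ] V →ₗ[ℝ] V) (hanti : ∀ u v w, R u v w = -R v u w)
    (hbianchi : ∀ u v w, R u v w + R v w u + R w u v = 0)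
    (hR : ∀ u v, ∃ β : Fin 3 → ℝ, ∀ c w,
      imag J c (R u v w) - R u v (imag J c w) = imag J (c ⨯₃ β) w)
    {c : Fin 3 → ℝ} (hc : c ≠ 0) (hcomm : ∀ u v w, R u v (imag J c w) = imag J c (R u v w)) :
    ∑ j, ∑ k, g (R (b k) (b j) (b' j)) (b' k) = 0 := by
  obtain ⟨d, hd, hcd⟩ := exists_unit_orthogonal c
  have hpos : 0 < c ⬝ᵥ c := lt_of_le_of_ne (Finset.sum_nonneg fun i _ => mul_self_nonneg (c i))
    fun h => hc (dotProduct_self_eq_zero.1 h.symm)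
  have hne : √(c ⬝ᵥ c) ≠ 0 := (Real.sqrt_pos.2 hpos).ne'
  have hsq := Real.mul_self_sqrt hpos.le
  set r : ℝ := (√(c ⬝ᵥ c))⁻¹ with hr
  have hsmul : ∀ v, imag J (r • c) v = r • imag J c v := fun v => by
    simp only [imag_apply, Pi.smul_apply, smul_eq_mul]; module
  have h0 : ∀ v, imag J (0 : Fin 3 → ℝ) v = 0 := fun v => by simp [imag_apply]
  have hunit : ∀ e : Fin 3 → ℝ, e ⬝ᵥ e = 1 → ∀ v, imag J e (imag J e v) = -v := fun e he v => by
    rw [hJ.imag_imag, he, cross_self, h0]; simp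
  have hrc : (r • c) ⬝ᵥ (r • c) = 1 := by
    simp only [smul_dotProduct, dotProduct_smul, smul_eq_mul, hr]
    field_simp
    linarith
  have hneg : ∀ (e : Fin 3 → ℝ) v, imag J (-e) v = -imag J e v := fun e v => by
    simp only [imag_apply, Pi.neg_apply]; module
  refine hb.scalar_eq_zero_of_commute hn0 hn4 R hanti hbianchi (imag J (r • c)) (imag J d)
    (hunit _ hrc) (hunit _ hd) (fun v => ?_) (hJ.imag_skew _) (hJ.imag_skew _)
    (fun u v w => ?_) (fun u v => ?_)
  · rw [hJ.imag_imag, hJ.imag_imag, dotProduct_comm d, smul_dotProduct, hcd, ← cross_anticomm,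
      hneg]
    simp
  · rw [hsmul, hsmul, map_smul, hcomm]
  · obtain ⟨β, hβ⟩ := hR u v
    obtain ⟨w₀, hw₀⟩ := exists_ne (0 : V)
    -- `R(u, v)` fixes `c`, so its rotation vector is a multiple of `c`.
    have h1 : c ⨯₃ β = 0 := hJ.eq_zero_of_imag_apply hw₀ (by rw [← hβ, hcomm, sub_self])
    obtain ⟨t, ht⟩ := eq_smul_of_cross_eq_zero hc h1
    refine ⟨t * r⁻¹, fun w => ?_⟩
    have hr0 : r ≠ 0 := inv_ne_zero hne
    rw [hsmul, smul_smul, mul_assoc, inv_mul_cancel₀ hr0, mul_one, hJ.imag_imag, hcd,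
      ← neg_sub, hβ, ht, map_smul, ← cross_anticomm d c]
    simp only [imag_apply, Pi.smul_apply, Pi.neg_apply, smul_eq_mul]
    module

end LinearAlgebra

/-! ### Extension of vector fields and the commutator of derivations -/

section Calculus

open Topology FiberBundle

variable {E : Type*} [NormedAddCommGroup E] [NormedSpace ℝ E]
  {M : Type*} [TopologicalSpace M] [ChartedSpace E M]
  [IsManifold 𝓘(ℝ, E) ∞ M]

/-- Differentiability at a point of a vector field which need not be smooth. -/
abbrev DiffAt (σ : ∀ y : M, Tan E y) (x : M) : Prop :=
  MDifferentiableAt 𝓘(ℝ, E) (𝓘(ℝ, E).prod 𝓘(ℝ, E))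
    (fun y : M => (⟨y, σ y⟩ : TotalSpace E (fun y : M => Tan E y))) x

/-- Smoothness on a set of a vector field. -/
abbrev SmoothOn (σ : ∀ y : M, Tan E y) (U : Set M) : Prop :=
  ContMDiffOn 𝓘(ℝ, E) (𝓘(ℝ, E).prod 𝓘(ℝ, E)) ∞
    (fun y : M => (⟨y, σ y⟩ : TotalSpace E (fun y : M => Tan E y))) U

theorem VField.diffAt (X : VField E M) (x : M) : DiffAt (fun y => X y) x := X.mdifferentiableAt

theorem DiffAt.congr {σ τ : ∀ y : M, Tan E y} {x : M} (h : DiffAt σ x)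
    (hστ : ∀ᶠ y in 𝓝 x, τ y = σ y) : DiffAt τ x :=
  MDifferentiableAt.congr_of_eventuallyEq h (hστ.mono fun y hy => by simp only [hy])

/-- A local vector field agrees near a point with a global one. -/
theorem exists_vField_eventuallyEq [FiniteDimensional ℝ E] [T2Space M] {σ : ∀ y : M, Tan E y}
    {x : M} {U : Set M} (hU : U ∈ 𝓝 x) (hσ : SmoothOn σ U) :
    ∃ S : VField E M, ∀ᶠ y in 𝓝 x, S y = σ y := by
  obtain ⟨W, hWU, hW, hxW⟩ := mem_nhds_iff.1 hU
  obtain ⟨f, -, hf⟩ := (SmoothBumpFunction.nhds_basis_tsupport (I := 𝓘(ℝ, E)) x).mem_iff.1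
    (hW.mem_nhds hxW)
  refine ⟨⟨(f : M → ℝ) • σ, ContMDiffOn.smul_section_of_tsupport f.contMDiff.contMDiffOn hW hf
    (hσ.mono hWU)⟩, ?_⟩
  filter_upwards [f.eventuallyEq_one] with y hy
  change f y • σ y = σ y
  rw [hy, Pi.one_apply, one_smul]

/-- Linear extension of tangent vectors to global vector fields, which agree near `x` with the local
extensions in the definition of `curvature`. -/
theorem exists_linear_extension [FiniteDimensional ℝ E] [T2Space M] (x : M) :
    ∃ e : Tan E x →ₗ[ℝ] VField E M, ∀ u, ∀ᶠ y in 𝓝 x,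
      e u y = (extend E u : ∀ y, Tan E y) y := by
  set t := trivializationAt E (fun y : M => Tan E y) x with ht
  have hx : x ∈ t.baseSet := FiberBundle.mem_baseSet_trivializationAt' x
  obtain ⟨f, -, hf⟩ := (SmoothBumpFunction.nhds_basis_tsupport (I := 𝓘(ℝ, E)) x).mem_iff.1
    (t.open_baseSet.mem_nhds hx)
  have heq : ∀ (u : Tan E x), ∀ y ∈ t.baseSet,
      (extend E u : ∀ y, Tan E y) y = t.symmL ℝ y (t.continuousLinearMapAt ℝ x u) := by
    intro u y hy
    rw [Trivialization.symmL_apply t hy, Trivialization.continuousLinearMapAt_apply_of_mem ℝ t hx]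
    rfl
  have hsm : ∀ u : Tan E x, SmoothOn (extend E u : ∀ y, Tan E y) t.baseSet := by
    intro u y hy
    rw [t.contMDiffWithinAt_section _ hy]
    have h1 : ∀ z ∈ t.baseSet, (t ⟨z, (extend E u : ∀ y, Tan E y) z⟩).2 = (t ⟨x, u⟩).2 := by
      intro z hz
      change (t ⟨z, t.symm z (t ⟨x, u⟩).2⟩).2 = _
      rw [t.apply_mk_symm hz]
    exact (contMDiffWithinAt_const (c := (t ⟨x, u⟩).2)).congr h1 (h1 y hy)
  refine ⟨{ toFun := fun u => ⟨(f : M → ℝ) • (extend E u : ∀ y, Tan E y),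
              ContMDiffOn.smul_section_of_tsupport f.contMDiff.contMDiffOn t.open_baseSet hf
                (hsm u)⟩
            map_add' := ?_
            map_smul' := ?_ }, ?_⟩
  · intro u v
    ext y
    change f y • (extend E (u + v) : ∀ y, Tan E y) y = f y • (extend E u : ∀ y, Tan E y) y +
      f y • (extend E v : ∀ y, Tan E y) y
    by_cases hy : y ∈ t.baseSet
    · rw [heq _ y hy, heq _ y hy, heq _ y hy, map_add, map_add, smul_add]
    · have : f y = 0 := image_eq_zero_of_notMem_tsupport fun h => hy (hf h)
      simp [this]
  · intro c u
    ext y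
    change f y • (extend E (c • u) : ∀ y, Tan E y) y = c • (f y • (extend E u : ∀ y, Tan E y) y)
    by_cases hy : y ∈ t.baseSet
    · rw [heq _ y hy, heq _ y hy, map_smul, map_smul, smul_comm]
    · have : f y = 0 := image_eq_zero_of_notMem_tsupport fun h => hy (hf h)
      simp [this]
  · intro u
    filter_upwards [f.eventuallyEq_one] with y hy
    change f y • (extend E u : ∀ y, Tan E y) y = _
    rw [hy, Pi.one_apply, one_smul]

theorem exists_vField_apply_eq [FiniteDimensional ℝ E] [T2Space M] {x : M} (u : Tan E x) :
    ∃ S : VField E M, S x = u := by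
  obtain ⟨e, he⟩ := exists_linear_extension (E := E) x
  exact ⟨e u, by rw [(he u).self_of_nhds]; simp⟩

section Connection

variable (D : Conn E M)

theorem conn_congr {σ τ : ∀ y : M, Tan E y} {x : M} (hσ : DiffAt σ x)
    (h : ∀ᶠ y in 𝓝 x, σ y = τ y) : D σ x = D τ x :=
  D.isCovariantDerivativeOnUniv.congr_of_eventuallyEq hσ
    (hσ.congr (h.mono fun _ hy => hy.symm)) Filter.univ_mem h

theorem conn_add (Y Z : VField E M) (x : M) :
    D (fun y => (Y + Z) y) x = D (fun y => Y y) x + D (fun y => Z y) x :=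
  D.isCovariantDerivativeOnUniv.add (Y.diffAt x) (Z.diffAt x)

theorem conn_smul (c : ℝ) (Y : VField E M) (x : M) :
    D (fun y => (c • Y) y) x = c • D (fun y => Y y) x :=
  D.isCovariantDerivativeOnUniv.smul_const c (Y.diffAt x)

variable [D.ContMDiffCovariantDerivative ∞]

theorem nabla_apply (X Y : VField E M) (x : M) : nabla D X Y x = D (fun y => Y y) x (X x) := rfl

/-- The covariant derivative as a bilinear map on vector fields. -/
def nablaₗ : VField E M →ₗ[ℝ] VField E M →ₗ[ℝ] VField E M :=
  LinearMap.mk₂ ℝ (nabla D)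
    (fun X X' Y => by
      ext x; change D Y x (X x + X' x) = D Y x (X x) + D Y x (X' x); rw [map_add])
    (fun c X Y => by ext x; change D Y x (c • X x) = c • D Y x (X x); rw [map_smul])
    (fun X Y Y' => by
      ext x
      change D (fun y => (Y + Y') y) x (X x) = _
      rw [conn_add]; rfl)
    (fun c X Y => by
      ext x
      change D (fun y => (c • Y) y) x (X x) = _
      rw [conn_smul]; rfl)

theorem isManifold_minSmoothness : IsManifold 𝓘(ℝ, E) (minSmoothness ℝ 3) M := by
  rw [minSmoothness_of_isRCLikeNormedField]; infer_instance

variable [FiniteDimensional ℝ E]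

variable (E M) in
/-- The Lie bracket as a bilinear map on vector fields. -/
def lieBrₗ : VField E M →ₗ[ℝ] VField E M →ₗ[ℝ] VField E M :=
  LinearMap.mk₂ ℝ lieBr
    (fun X X' Y => by
      have := FiniteDimensional.complete ℝ E
      ext x; exact VectorField.mlieBracket_add_left (X.diffAt x) (X'.diffAt x))
    (fun c X Y => by
      have := FiniteDimensional.complete ℝ E
      ext x; exact VectorField.mlieBracket_const_smul_left (X.diffAt x))
    (fun X Y Y' => by
      have := FiniteDimensional.complete ℝ E
      ext x; exact VectorField.mlieBracket_add_right (Y.diffAt x) (Y'.diffAt x))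
    (fun c X Y => by
      have := FiniteDimensional.complete ℝ E
      ext x; exact VectorField.mlieBracket_const_smul_right (Y.diffAt x))

theorem lieBr_swap (X Y : VField E M) : lieBr X Y = -lieBr Y X := by
  ext x; exact VectorField.mlieBracket_swap_apply

theorem lieBr_leibniz (X Y Z : VField E M) :
    lieBr X (lieBr Y Z) = lieBr (lieBr X Y) Z + lieBr Y (lieBr X Z) := by
  have := FiniteDimensional.complete ℝ E
  have := isManifold_minSmoothness (E := E) (M := M)
  ext x
  have h : minSmoothness ℝ 2 ≤ (∞ : ℕ∞ω) := by
    rw [minSmoothness_of_isRCLikeNormedField]; exact ENat.LEInfty.out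
  exact VectorField.leibniz_identity_mlieBracket_apply ((X.contMDiff x).of_le h)
    ((Y.contMDiff x).of_le h) ((Z.contMDiff x).of_le h)

/-- The commutator of two derivations is the derivation along the Lie bracket. This follows from
the Jacobi identity for `X`, `Y` and `h Z`. -/
theorem dirDeriv_commutator [T2Space M] [Nontrivial E] (X Y : VField E M) {h : M → ℝ}
    (hh : CMDiff ∞ h) (x : M) (hX : MDiffAt (dirDeriv X h) x) (hY : MDiffAt (dirDeriv Y h) x) :
    dirDeriv X (dirDeriv Y h) x - dirDeriv Y (dirDeriv X h) x = dirDeriv (lieBr X Y) h x := by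
  have := FiniteDimensional.complete ℝ E
  have := isManifold_minSmoothness (E := E) (M := M)
  have hh1 : ∀ y, MDiffAt h y := fun y => (hh y).mdifferentiableAt (by simp)
  obtain ⟨w, hw⟩ := exists_ne (0 : E)
  obtain ⟨Z, hZ⟩ := exists_vField_apply_eq (x := x) (w : Tan E x)
  let smulF : VField E M → VField E M := fun W => ⟨h • W, hh.smul_section W.contMDiff⟩
  have hbr : ∀ U W : VField E M, lieBr U (smulF W) = (dirDeriv U h • ⇑W + h • ⇑(lieBr U W)) := by
    intro U W
    ext y
    exact VectorField.mlieBracket_smul_right (hh1 y) (W.diffAt y)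
  have hd : ∀ (U W : VField E M), MDiffAt (dirDeriv W h) x →
      VectorField.mlieBracket 𝓘(ℝ, E) U (dirDeriv W h • ⇑Z) x =
      dirDeriv U (dirDeriv W h) x • Z x + dirDeriv W h x • lieBr U Z x := by
    intro U W hW
    exact VectorField.mlieBracket_smul_right hW (Z.diffAt x)
  have hmain : ∀ (U W : VField E M), MDiffAt (dirDeriv W h) x →
      lieBr U (lieBr W (smulF Z)) x = (dirDeriv U (dirDeriv W h) x • Z x
        + dirDeriv W h x • lieBr U Z x) + (dirDeriv U h x • lieBr W Z x
        + h x • lieBr U (lieBr W Z) x) := by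
    intro U W hW
    change VectorField.mlieBracket 𝓘(ℝ, E) U (lieBr W (smulF Z)) x = _
    rw [hbr, VectorField.mlieBracket_add_right, hd U W hW]
    · congr 1
      exact VectorField.mlieBracket_smul_right (hh1 x) ((lieBr W Z).diffAt x)
    · exact hW.smul_section (Z.diffAt x)
    · exact (hh1 x).smul_section ((lieBr W Z).diffAt x)
  have hJ := congrArg (fun S : VField E M => S x) (lieBr_leibniz X Y (smulF Z))
  have hJ' := congrArg (fun S : VField E M => S x) (lieBr_leibniz X Y Z)
  simp only [ContMDiffSection.coe_add, Pi.add_apply] at hJ hJ'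
  have h3 : lieBr (lieBr X Y) (smulF Z) x =
      dirDeriv (lieBr X Y) h x • Z x + h x • lieBr (lieBr X Y) Z x := congrFun (hbr _ _) x
  rw [hmain X Y hY, hmain Y X hX, h3, hJ'] at hJ
  have h4 : (dirDeriv X (dirDeriv Y h) x - dirDeriv Y (dirDeriv X h) x
      - dirDeriv (lieBr X Y) h x) • Z x = 0 := by
    rw [← sub_eq_zero] at hJ
    rw [← hJ]
    module
  rw [hZ] at h4
  exact sub_eq_zero.1 ((smul_eq_zero.1 h4).resolve_right hw)

end Connection

end Calculus

/-! ### Curvature and the Ricci identity -/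

section Curvature

open Topology FiberBundle

variable {E : Type*} [NormedAddCommGroup E] [NormedSpace ℝ E]
  {M : Type*} [TopologicalSpace M] [ChartedSpace E M] [IsManifold 𝓘(ℝ, E) ∞ M]

set_option synthInstance.maxHeartbeats 400000 in
omit [IsManifold 𝓘(ℝ, E) ∞ M] in
theorem Bil.sub_left {x : M} (β : Bil E x) (u v w : Tan E x) : β (u - v) w = β u w - β v w := by
  rw [map_sub]; rfl

theorem dirDeriv_add (X : VField E M) {h k : M → ℝ} {x : M} (hh : MDiffAt h x) (hk : MDiffAt k x) :
    dirDeriv X (h + k) x = dirDeriv X h x + dirDeriv X k x := by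
  simp only [dirDeriv]
  rw [mvfderiv_add hh hk]; rfl

theorem dirDeriv_mul (X : VField E M) {h k : M → ℝ} {x : M} (hh : MDiffAt h x) (hk : MDiffAt k x) :
    dirDeriv X (h * k) x = dirDeriv X h x * k x + h x * dirDeriv X k x := by
  simp only [dirDeriv]
  rw [mvfderiv_mul hh hk, add_comm, mul_comm (mvfderiv 𝓘(ℝ, E) h x (X x))]
  rfl

theorem dirDeriv_congr (X : VField E M) {h k : M → ℝ} {x : M} (hk : h =ᶠ[𝓝 x] k) :
    dirDeriv X h x = dirDeriv X k x := by
  simp only [dirDeriv, mvfderiv]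
  rw [hk.mfderiv_eq, hk.self_of_nhds]

theorem dirDeriv_zero (X : VField E M) (x : M) : dirDeriv X (fun _ => 0) x = 0 := by
  simp only [dirDeriv]
  rw [mvfderiv_const]; rfl

theorem contMDiff_ofField {β : ∀ x : M, Bil E x}
    (hβ : ContMDiff 𝓘(ℝ, E) (𝓘(ℝ, E).prod 𝓘(ℝ, E →L[ℝ] E →L[ℝ] ℝ)) ∞ (fun x : M =>
      (⟨x, β x⟩ : TotalSpace (E →L[ℝ] E →L[ℝ] ℝ) (fun x : M => Bil E x)))) (Y Z : VField E M) :
    CMDiff ∞ (Tensor₂.ofField β Y Z) := by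
  have h := hβ.clm_bundle_apply₂ (F₁ := E) (F₂ := E) (F₃ := ℝ) Y.contMDiff Z.contMDiff
  exact fun x => (contMDiffAt_section x).1 (h x)

theorem contMDiff_inner (g : Metric E M) (Y Z : VField E M) :
    CMDiff ∞ (fun y => g.inner y (Y y) (Z y)) :=
  contMDiff_ofField g.contMDiff Y Z

variable (D : Conn E M) [D.ContMDiffCovariantDerivative ∞] [FiniteDimensional ℝ E]

/-- The curvature `R(X, Y) Z` of three vector fields. -/
def curvField (X Y Z : VField E M) : VField E M :=
  nabla D X (nabla D Y Z) - nabla D Y (nabla D X Z) - nabla D (lieBr X Y) Z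

/-- The Ricci identity for a covariant `2`-tensor. -/
theorem ricci_identity₂ [T2Space M] [Nontrivial E] (β : ∀ x : M, Bil E x)
    (hβ : ∀ Z W : VField E M, CMDiff ∞ (Tensor₂.ofField β Z W))
    (hγ : ∀ X Z W : VField E M, MDiff (nablaTensor₂ D X (Tensor₂.ofField β) Z W))
    (X Y Z W : VField E M) (x : M) :
    nablaTensor₂ D X (nablaTensor₂ D Y (Tensor₂.ofField β)) Z W x
      - nablaTensor₂ D Y (nablaTensor₂ D X (Tensor₂.ofField β)) Z W x
      - nablaTensor₂ D (lieBr X Y) (Tensor₂.ofField β) Z W x =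
    -(β x (curvField D X Y Z x) (W x) + β x (Z x) (curvField D X Y W x)) := by
  have hβ1 : ∀ (Z W : VField E M) y, MDiffAt (Tensor₂.ofField β Z W) y :=
    fun Z W y => (hβ Z W y).mdifferentiableAt (by simp)
  have hdir : ∀ X Z W : VField E M, dirDeriv X (Tensor₂.ofField β Z W) =
      fun y => nablaTensor₂ D X (Tensor₂.ofField β) Z W y
        + (Tensor₂.ofField β (nabla D X Z) W y + Tensor₂.ofField β Z (nabla D X W) y) := by
    intro X Z W
    funext y
    simp only [nablaTensor₂, Pi.sub_apply]
    ring
  have hmd : ∀ X Z W : VField E M, MDiffAt (dirDeriv X (Tensor₂.ofField β Z W)) x := by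
    intro X Z W
    rw [hdir]
    exact (hγ X Z W x).add ((hβ1 _ _ x).add (hβ1 _ _ x))
  have hcomm := dirDeriv_commutator X Y (hβ Z W) x (hmd X Z W) (hmd Y Z W)
  have hsecond : ∀ X Y : VField E M, dirDeriv X (dirDeriv Y (Tensor₂.ofField β Z W)) x =
      dirDeriv X (nablaTensor₂ D Y (Tensor₂.ofField β) Z W) x
      + (dirDeriv X (Tensor₂.ofField β (nabla D Y Z) W) x
        + dirDeriv X (Tensor₂.ofField β Z (nabla D Y W)) x) := by
    intro X Y
    rw [hdir Y]
    change dirDeriv X (nablaTensor₂ D Y (Tensor₂.ofField β) Z W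
      + (Tensor₂.ofField β (nabla D Y Z) W + Tensor₂.ofField β Z (nabla D Y W))) x = _
    rw [dirDeriv_add X (hγ Y Z W x) ((hβ1 _ _ x).add (hβ1 _ _ x)),
      dirDeriv_add X (hβ1 _ _ x) (hβ1 _ _ x)]
  rw [hsecond X Y, hsecond Y X] at hcomm
  have e1 : β x (curvField D X Y Z x) (W x) = β x (nabla D X (nabla D Y Z) x) (W x)
      - β x (nabla D Y (nabla D X Z) x) (W x) - β x (nabla D (lieBr X Y) Z x) (W x) := by
    simp only [curvField, ContMDiffSection.coe_sub, Pi.sub_apply, Bil.sub_left]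
  have e2 : β x (Z x) (curvField D X Y W x) = β x (Z x) (nabla D X (nabla D Y W) x)
      - β x (Z x) (nabla D Y (nabla D X W) x) - β x (Z x) (nabla D (lieBr X Y) W x) := by
    simp only [curvField, ContMDiffSection.coe_sub, Pi.sub_apply, map_sub]
  rw [e1, e2]
  simp only [nablaTensor₂, Pi.sub_apply]
  simp only [nablaTensor₂] at hcomm
  simp only [Tensor₂.ofField] at hcomm ⊢
  linear_combination hcomm

/-- A parallel covariant `4`-tensor is annihilated by the curvature. -/
theorem curvField_annihilates [T2Space M] [Nontrivial E]
    (Ω : ∀ x : M, Tan E x → Tan E x → Tan E x → Tan E x → ℝ)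
    (h1 : ∀ x a a' b c d, Ω x (a - a') b c d = Ω x a b c d - Ω x a' b c d)
    (h2 : ∀ x a b b' c d, Ω x a (b - b') c d = Ω x a b c d - Ω x a b' c d)
    (h3 : ∀ x a b c c' d, Ω x a b (c - c') d = Ω x a b c d - Ω x a b c' d)
    (h4 : ∀ x a b c d d', Ω x a b c (d - d') = Ω x a b c d - Ω x a b c d')
    (hΩ : ∀ Y₁ Y₂ Y₃ Y₄ : VField E M, CMDiff ∞ (fun y => Ω y (Y₁ y) (Y₂ y) (Y₃ y) (Y₄ y)))
    (hpar : ∀ (X Y₁ Y₂ Y₃ Y₄ : VField E M) (x : M), deriv₄ X (nabla D X) Ω Y₁ Y₂ Y₃ Y₄ x = 0)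
    (X Y Z₁ Z₂ Z₃ Z₄ : VField E M) (x : M) :
    Ω x (curvField D X Y Z₁ x) (Z₂ x) (Z₃ x) (Z₄ x)
      + Ω x (Z₁ x) (curvField D X Y Z₂ x) (Z₃ x) (Z₄ x)
      + Ω x (Z₁ x) (Z₂ x) (curvField D X Y Z₃ x) (Z₄ x)
      + Ω x (Z₁ x) (Z₂ x) (Z₃ x) (curvField D X Y Z₄ x) = 0 := by
  have hd : ∀ (Y₁ Y₂ Y₃ Y₄ : VField E M) y, MDiffAt (fun y => Ω y (Y₁ y) (Y₂ y) (Y₃ y) (Y₄ y)) y :=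
    fun Y₁ Y₂ Y₃ Y₄ y => (hΩ Y₁ Y₂ Y₃ Y₄ y).mdifferentiableAt (by simp)
  have hdir : ∀ X Y₁ Y₂ Y₃ Y₄ : VField E M,
      dirDeriv X (fun y => Ω y (Y₁ y) (Y₂ y) (Y₃ y) (Y₄ y)) =
      fun x => (Ω x (nabla D X Y₁ x) (Y₂ x) (Y₃ x) (Y₄ x)
          + Ω x (Y₁ x) (nabla D X Y₂ x) (Y₃ x) (Y₄ x))
        + (Ω x (Y₁ x) (Y₂ x) (nabla D X Y₃ x) (Y₄ x)
          + Ω x (Y₁ x) (Y₂ x) (Y₃ x) (nabla D X Y₄ x)) := by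
    intro X Y₁ Y₂ Y₃ Y₄
    funext y
    have := hpar X Y₁ Y₂ Y₃ Y₄ y
    simp only [deriv₄] at this
    linarith
  have hmd : ∀ X : VField E M,
      MDiffAt (dirDeriv X (fun y => Ω y (Z₁ y) (Z₂ y) (Z₃ y) (Z₄ y))) x := by
    intro X
    rw [hdir]
    exact ((hd _ _ _ _ x).add (hd _ _ _ _ x)).add ((hd _ _ _ _ x).add (hd _ _ _ _ x))
  have hcomm := dirDeriv_commutator X Y (hΩ Z₁ Z₂ Z₃ Z₄) x (hmd X) (hmd Y)
  have hsecond : ∀ X Y : VField E M,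
      dirDeriv X (dirDeriv Y (fun y => Ω y (Z₁ y) (Z₂ y) (Z₃ y) (Z₄ y))) x =
      (dirDeriv X (fun x => Ω x (nabla D Y Z₁ x) (Z₂ x) (Z₃ x) (Z₄ x)) x
        + dirDeriv X (fun x => Ω x (Z₁ x) (nabla D Y Z₂ x) (Z₃ x) (Z₄ x)) x)
      + (dirDeriv X (fun x => Ω x (Z₁ x) (Z₂ x) (nabla D Y Z₃ x) (Z₄ x)) x
        + dirDeriv X (fun x => Ω x (Z₁ x) (Z₂ x) (Z₃ x) (nabla D Y Z₄ x)) x) := by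
    intro X Y
    rw [hdir Y]
    change dirDeriv X (((fun x => Ω x (nabla D Y Z₁ x) (Z₂ x) (Z₃ x) (Z₄ x))
      + (fun x => Ω x (Z₁ x) (nabla D Y Z₂ x) (Z₃ x) (Z₄ x)))
      + ((fun x => Ω x (Z₁ x) (Z₂ x) (nabla D Y Z₃ x) (Z₄ x))
      + (fun x => Ω x (Z₁ x) (Z₂ x) (Z₃ x) (nabla D Y Z₄ x)))) x = _
    rw [dirDeriv_add X ((hd _ _ _ _ x).add (hd _ _ _ _ x))
      ((hd _ _ _ _ x).add (hd _ _ _ _ x)), dirDeriv_add X (hd _ _ _ _ x) (hd _ _ _ _ x),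
      dirDeriv_add X (hd _ _ _ _ x) (hd _ _ _ _ x)]
  rw [hsecond X Y, hsecond Y X] at hcomm
  simp only [hdir] at hcomm
  simp only [curvField, ContMDiffSection.coe_sub, Pi.sub_apply, h1, h2, h3, h4]
  linear_combination hcomm

variable {D}

theorem curvField_antisymm (X Y Z : VField E M) : curvField D X Y Z = -curvField D Y X Z := by
  have h : nabla D (-lieBr Y X) Z = -nabla D (lieBr Y X) Z :=
    LinearMap.map_neg₂ (nablaₗ D) (lieBr Y X) Z
  rw [curvField, curvField, lieBr_swap X Y, h]
  abel

theorem IsLeviCivita.bianchi {g : Metric E M} (hD : IsLeviCivita g D) (X Y Z : VField E M) :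
    curvField D X Y Z + curvField D Y Z X + curvField D Z X Y = 0 := by
  have hsub : ∀ X Y Z : VField E M, nabla D X (Y - Z) = nabla D X Y - nabla D X Z :=
    fun X Y Z => (nablaₗ D X).map_sub Y Z
  have hneg : ∀ X Y : VField E M, lieBr X (-Y) = -lieBr X Y :=
    fun X Y => (lieBrₗ E M X).map_neg Y
  have hT := hD.torsion_free
  have key : curvField D X Y Z + curvField D Y Z X + curvField D Z X Y =
      lieBr X (lieBr Y Z) + lieBr Y (lieBr Z X) + lieBr Z (lieBr X Y) := by
    rw [← hT X (lieBr Y Z), ← hT Y (lieBr Z X), ← hT Z (lieBr X Y)]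
    simp only [curvField]
    rw [← hT X Y, ← hT Y Z, ← hT Z X]
    simp only [hsub]
    abel
  rw [key, lieBr_leibniz X Y Z, lieBr_swap (lieBr X Y) Z, lieBr_swap Z X, hneg]
  abel

variable (D)

/-- The Riemann curvature as a trilinear map on a tangent space, computed with a linear extension
`e` of tangent vectors to vector fields. -/
theorem exists_curvature_linearMap [T2Space M] (x : M) :
    ∃ (e : Tan E x →ₗ[ℝ] VField E M) (R : Tan E x →ₗ[ℝ] Tan E x →ₗ[ℝ] Tan E x →ₗ[ℝ] Tan E x),
      (∀ u, e u x = u) ∧ (∀ u v w, R u v w = curvField D (e u) (e v) (e w) x) ∧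
      ∀ u v w, R u v w = curvature D x u v w := by
  obtain ⟨e, he⟩ := exists_linear_extension (E := E) x
  let C : VField E M →ₗ[ℝ] VField E M →ₗ[ℝ] VField E M →ₗ[ℝ] VField E M :=
    LinearMap.mk₂ ℝ (fun X Y => nablaₗ D X ∘ₗ nablaₗ D Y - nablaₗ D Y ∘ₗ nablaₗ D X
        - nablaₗ D (lieBrₗ E M X Y))
      (fun X X' Y => by
        simp only [map_add, LinearMap.add_apply, LinearMap.comp_add, LinearMap.add_comp]; abel)
      (fun c X Y => by
        simp only [map_smul, LinearMap.smul_apply, LinearMap.comp_smul, LinearMap.smul_comp,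
          smul_sub])
      (fun X Y Y' => by
        simp only [map_add, LinearMap.add_comp, LinearMap.comp_add]; abel)
      (fun c X Y => by
        simp only [map_smul, LinearMap.comp_smul, LinearMap.smul_comp, smul_sub])
  let ev : VField E M →ₗ[ℝ] Tan E x :=
    { toFun := fun X => X x, map_add' := fun _ _ => rfl, map_smul' := fun _ _ => rfl }
  refine ⟨e, LinearMap.mk₂ ℝ (fun u v => ev ∘ₗ C (e u) (e v) ∘ₗ e)
    (fun u u' v => by
      simp only [map_add, LinearMap.add_apply, LinearMap.add_comp, LinearMap.comp_add])
    (fun c u v => by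
      simp only [map_smul, LinearMap.smul_apply, LinearMap.smul_comp, LinearMap.comp_smul])
    (fun u v v' => by
      simp only [map_add, LinearMap.add_comp, LinearMap.comp_add])
    (fun c u v => by
      simp only [map_smul, LinearMap.smul_comp, LinearMap.comp_smul]), fun u => ?_,
    fun u v w => rfl, fun u v w => ?_⟩
  · rw [(he u).self_of_nhds]; simp
  · change curvField D (e u) (e v) (e w) x = _
    have hx : ∀ u, e u x = u := fun u => by rw [(he u).self_of_nhds]; simp
    have h1 : ∀ v w : Tan E x, ∀ᶠ y in 𝓝 x, nabla D (e v) (e w) y =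
        D (extend E w : ∀ y, Tan E y) y ((extend E v : ∀ y, Tan E y) y) := by
      intro v w
      filter_upwards [(he w).eventually_nhds, he v] with y hw hv
      rw [nabla_apply, conn_congr D ((e w).diffAt y) hw, hv]
    have h2 : ∀ u v w : Tan E x, nabla D (e u) (nabla D (e v) (e w)) x =
        D (fun y => D (extend E w : ∀ y, Tan E y) y ((extend E v : ∀ y, Tan E y) y)) x u := by
      intro u v w
      rw [nabla_apply, conn_congr D ((nabla D (e v) (e w)).diffAt x) (h1 v w), hx]
    have h3 : lieBr (e u) (e v) x =
        VectorField.mlieBracket 𝓘(ℝ, E) (extend E u : ∀ y, Tan E y) (extend E v) x :=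
      Filter.EventuallyEq.mlieBracket_vectorField_eq (he u) (he v)
    have h4 : nabla D (lieBr (e u) (e v)) (e w) x = D (extend E w : ∀ y, Tan E y) x
        (VectorField.mlieBracket 𝓘(ℝ, E) (extend E u : ∀ y, Tan E y) (extend E v) x) := by
      rw [nabla_apply, conn_congr D ((e w).diffAt x) (he w), h3]
    change nabla D (e u) (nabla D (e v) (e w)) x - nabla D (e v) (nabla D (e u) (e w)) x
      - nabla D (lieBr (e u) (e v)) (e w) x = _
    rw [h2, h2, h4]
    rfl

end Curvature

/-! ### The metric in a basis and derivatives of endomorphism fields -/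

section Frames

open Topology FiberBundle

variable {E : Type*} [NormedAddCommGroup E] [NormedSpace ℝ E]
  {M : Type*} [TopologicalSpace M] [ChartedSpace E M] [IsManifold 𝓘(ℝ, E) ∞ M]

/-- The metric at a point as a bilinear form. -/
def metricₗ (g : Metric E M) (x : M) : Tan E x →ₗ[ℝ] Tan E x →ₗ[ℝ] ℝ :=
  LinearMap.mk₂ ℝ (fun u v => g.inner x u v)
    (fun u v w => by rw [map_add]; rfl) (fun c u v => by rw [map_smul]; rfl)
    (fun u v w => by rw [map_add]) (fun c u v => by rw [map_smul])

theorem metricₗ_apply (g : Metric E M) (x : M) (u v : Tan E x) :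
    metricₗ g x u v = g.inner x u v := rfl

theorem metricₗ_symm (g : Metric E M) (x : M) (u v : Tan E x) :
    metricₗ g x u v = metricₗ g x v u := g.symm x u v

theorem metricₗ_pos (g : Metric E M) (x : M) (v : Tan E x) (hv : v ≠ 0) : 0 < metricₗ g x v v :=
  g.pos x v hv

section DualBasis

variable [FiniteDimensional ℝ E]

/-- The Gram matrix of the basis `tanBasis x`. -/
def gram (g : Metric E M) (x : M) : Matrix (Fin (finrank ℝ E)) (Fin (finrank ℝ E)) ℝ :=
  Matrix.of fun a b => g.inner x (tanBasis x a) (tanBasis x b)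

/-- The basis of the tangent space which is `g`-dual to `tanBasis x`. -/
def dualBasis (g : Metric E M) (x : M) (j : Fin (finrank ℝ E)) : Tan E x :=
  ∑ k, (gram g x)⁻¹ j k • tanBasis x k

omit [FiniteDimensional ℝ E] in
theorem metricₗ_sum_smul_left (g : Metric E M) (x : M) {ι : Type*} [Fintype ι] (c : ι → ℝ)
    (b : ι → Tan E x) (w : Tan E x) :
    metricₗ g x (∑ i, c i • b i) w = ∑ i, c i * metricₗ g x (b i) w := by
  simp only [map_sum, map_smul, LinearMap.sum_apply, LinearMap.smul_apply, smul_eq_mul]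

theorem gram_det_ne_zero (g : Metric E M) (x : M) : (gram g x).det ≠ 0 := by
  intro h
  obtain ⟨v, hv, hG⟩ := Matrix.exists_mulVec_eq_zero_iff.2 h
  set u : Tan E x := ∑ j, v j • tanBasis x j with hu
  have h1 : ∀ i, metricₗ g x (tanBasis x i) u = 0 := by
    intro i
    have := congrFun hG i
    simp only [hu, map_sum, map_smul, smul_eq_mul]
    rw [← Pi.zero_apply (M := fun _ => ℝ) i, ← this]
    exact Finset.sum_congr rfl fun j _ => mul_comm _ _
  have h2 : metricₗ g x u u = 0 :=
    (metricₗ_sum_smul_left g x v _ u).trans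
      (Finset.sum_eq_zero fun i _ => by rw [h1, mul_zero])
  have h3 : u = 0 := by
    by_contra hne
    exact (metricₗ_pos g x u hne).ne' h2
  exact hv (funext fun i => Fintype.linearIndependent_iff.1 (tanBasis x).linearIndependent v h3 i)

theorem metricₗ_dualBasis (g : Metric E M) (x : M) (u : Tan E x) (k : Fin (finrank ℝ E)) :
    metricₗ g x u (dualBasis g x k) = (tanBasis x).repr u k := by
  have hinv : (gram g x)⁻¹ * gram g x = 1 :=
    Matrix.nonsing_inv_mul _ (isUnit_iff_ne_zero.2 (gram_det_ne_zero g x))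
  have h : ∀ l, metricₗ g x (tanBasis x l) (dualBasis g x k) = if k = l then 1 else 0 := by
    intro l
    have := congrFun (congrFun hinv k) l
    rw [Matrix.mul_apply, Matrix.one_apply] at this
    rw [← this, dualBasis, map_sum]
    refine Finset.sum_congr rfl fun m _ => ?_
    rw [map_smul, smul_eq_mul, metricₗ_symm]; rfl
  have h2 := metricₗ_sum_smul_left g x ((tanBasis x).repr u) (tanBasis x) (dualBasis g x k)
  rw [(tanBasis x).sum_repr] at h2
  simp [h2, h]

theorem isDualPair_dualBasis (g : Metric E M) (x : M) :
    IsDualPair (metricₗ g x) (tanBasis x) (dualBasis g x) := by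
  have hr : ∀ u, ∑ k, metricₗ g x u (dualBasis g x k) • tanBasis x k = u := fun u => by
    simp only [metricₗ_dualBasis]
    exact (tanBasis x).sum_repr u
  refine ⟨metricₗ_symm g x, fun u => ?_, hr⟩
  have h1 : ∀ w, metricₗ g x (∑ k, metricₗ g x u (tanBasis x k) • dualBasis g x k) w
      = metricₗ g x u w := by
    intro w
    conv_rhs => rw [← hr w]
    rw [metricₗ_sum_smul_left]
    simp only [map_sum, map_smul, smul_eq_mul]
    refine Finset.sum_congr rfl fun k _ => ?_
    rw [metricₗ_symm g x _ w, mul_comm]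
  by_contra hne
  refine (metricₗ_pos g x _ (sub_ne_zero.2 hne)).ne' ?_
  rw [LinearMap.map_sub₂, h1, sub_self]

theorem sum_metricₗ_dualBasis (g : Metric E M) (x : M) :
    ∑ k, metricₗ g x (tanBasis x k) (dualBasis g x k) = finrank ℝ E := by
  simp [metricₗ_dualBasis]

/-- The scalar curvature as a contraction of the curvature with a dual pair of bases. -/
theorem scalarCurvature_eq (g : Metric E M) (D : Conn E M) (x : M)
    (R : Tan E x →ₗ[ℝ] Tan E x →ₗ[ℝ] Tan E x →ₗ[ℝ] Tan E x)
    (hR : ∀ u v w, R u v w = curvature D x u v w) :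
    scalarCurvature g D x = ∑ j, ∑ k, metricₗ g x
      (R (tanBasis x k) (tanBasis x j) (dualBasis g x j)) (dualBasis g x k) := by
  rw [scalarCurvature]
  refine Finset.sum_congr rfl fun j _ => ?_
  simp only [ricci, ← hR, ← metricₗ_dualBasis g x]
  conv_rhs => rw [dualBasis]
  simp only [map_sum, map_smul, LinearMap.sum_apply, LinearMap.smul_apply, smul_eq_mul]
  rw [Finset.sum_comm]
  refine Finset.sum_congr rfl fun k _ => ?_
  rw [Finset.mul_sum]
  rfl

end DualBasis

theorem IsAlmostQuaternionic.isQuatTriple {g : Metric E M} {Q : ∀ x : M, Submodule ℝ (EndT E x)}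
    (hQ : IsAlmostQuaternionic g Q) {x : M} {J : Fin 3 → EndT E x} (hJ : IsQuatBasis (Q x) J) :
    IsQuatTriple (metricₗ g x) (fun i => (J i : Tan E x →ₗ[ℝ] Tan E x)) where
  sq i v := by
    have := congrArg (fun T : EndT E x => T v) (hJ.sq i); simpa using this
  mul i v := by
    have := congrArg (fun T : EndT E x => T v) (hJ.mul i); simpa using this
  mul_rev i v := by
    have := congrArg (fun T : EndT E x => T v) (hJ.mul_rev i); simpa using this
  skew i u v := by
    have hmem : J i ∈ Q x := hJ.span ▸ Submodule.subset_span ⟨i, rfl⟩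
    have h := hQ.compat x (J i) hmem (hJ.sq i) (J i u) v
    have h2 : J i (J i u) = -u := by
      have := congrArg (fun T : EndT E x => T u) (hJ.sq i); simpa using this
    rw [h2] at h
    change metricₗ g x (-u) (J i v) = metricₗ g x (J i u) v at h
    rw [map_neg, LinearMap.neg_apply] at h
    exact h.symm

theorem Theta_apply {g : Metric E M} {Q : ∀ x : M, Submodule ℝ (EndT E x)} {x : M}
    {J : Fin 3 → EndT E x} (hJ : IsQuatBasis (Q x) J) (a b c d : Tan E x) :
    Theta g Q x a b c d = ∑ i, metricₗ g x (J i a) b * metricₗ g x (J i c) d := by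
  rw [Theta_eq g Q x J hJ]
  simp [Fin.sum_univ_three, omega, metricₗ_apply]

section FrameDerivative

variable [FiniteDimensional ℝ E] [T2Space M]

/-- Differentiability at a point of a field of endomorphisms. -/
abbrev EndDiffAt (J : ∀ y : M, EndT E y) (x : M) : Prop :=
  MDifferentiableAt 𝓘(ℝ, E) (𝓘(ℝ, E).prod 𝓘(ℝ, E →L[ℝ] E))
    (fun y : M => (⟨y, J y⟩ : TotalSpace (E →L[ℝ] E) (fun y : M => EndT E y))) x

omit [FiniteDimensional ℝ E] [T2Space M] in
theorem EndDiffAt.apply {J : ∀ y : M, EndT E y} {σ : ∀ y : M, Tan E y} {x : M}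
    (hJ : EndDiffAt J x) (hσ : DiffAt σ x) : DiffAt (fun y => J y (σ y)) x :=
  MDifferentiableAt.clm_bundle_apply hJ hσ

omit [T2Space M] in
/-- The covariant derivative `C = ∇_u J` of a field of endomorphisms: the commutator of `∇_u` and
`J` is tensorial. -/
theorem exists_endomorphism_derivative (D : Conn E M) {J : ∀ y : M, EndT E y} {x : M}
    (hJ : EndDiffAt J x) (u : Tan E x) :
    ∃ C : Tan E x →L[ℝ] Tan E x, ∀ σ : ∀ y : M, Tan E y, DiffAt σ x →
      D (fun y => J y (σ y)) x u = C (σ x) + J x (D σ x u) := by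
  have hT : TensorialAt 𝓘(ℝ, E) E
      (fun σ : ∀ y : M, Tan E y => D (fun y => J y (σ y)) x u - J x (D σ x u)) x := by
    refine ⟨fun {f σ} hf hσ => ?_, fun {σ σ'} hσ hσ' => ?_⟩
    · have h1 : (fun y => J y ((f • σ) y)) = f • (fun y => J y (σ y)) := by
        funext y; exact map_smul (J y) (f y) (σ y)
      rw [h1, D.isCovariantDerivativeOnUniv.leibniz (hJ.apply hσ) hf,
        D.isCovariantDerivativeOnUniv.leibniz hσ hf]
      change f x • D (fun y => J y (σ y)) x u + (mvfderiv 𝓘(ℝ, E) f x u) • J x (σ x)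
        - J x (f x • D σ x u + (mvfderiv 𝓘(ℝ, E) f x u) • σ x) = _
      rw [map_add, map_smul, map_smul]
      module
    · have h1 : (fun y => J y ((σ + σ') y)) = (fun y => J y (σ y)) + (fun y => J y (σ' y)) := by
        funext y; exact map_add (J y) (σ y) (σ' y)
      rw [h1, D.isCovariantDerivativeOnUniv.add (hJ.apply hσ) (hJ.apply hσ'),
        D.isCovariantDerivativeOnUniv.add hσ hσ']
      change D (fun y => J y (σ y)) x u + D (fun y => J y (σ' y)) x u
        - J x (D σ x u + D σ' x u) = _
      rw [map_add]
      abel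
  refine ⟨TensorialAt.mkHom _ x hT, fun σ hσ => ?_⟩
  rw [TensorialAt.mkHom_apply hT hσ]
  abel

end FrameDerivative

end Frames

/-! ### The form `Θ` is parallel -/

section ParallelTheta

open Topology Matrix

variable {E : Type*} [NormedAddCommGroup E] [NormedSpace ℝ E]
  {M : Type*} [TopologicalSpace M] [ChartedSpace E M] [IsManifold 𝓘(ℝ, E) ∞ M]

/-- A smooth local quaternionic frame of `Q` on the open set `U`. -/
structure IsLocalFrame (Q : ∀ x : M, Submodule ℝ (EndT E x)) (J : Fin 3 → ∀ y : M, EndT E y)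
    (U : Set M) : Prop where
  isOpen : IsOpen U
  smooth : ∀ i, ContMDiffOn 𝓘(ℝ, E) (𝓘(ℝ, E).prod 𝓘(ℝ, E →L[ℝ] E)) ∞
      (fun y : M => (⟨y, J i y⟩ : TotalSpace (E →L[ℝ] E) (fun y : M => EndT E y))) U
  basis : ∀ y ∈ U, IsQuatBasis (Q y) (fun i => J i y)

theorem IsAlmostQuaternionic.exists_isLocalFrame {g : Metric E M}
    {Q : ∀ x : M, Submodule ℝ (EndT E x)} (hQ : IsAlmostQuaternionic g Q) (x : M) :
    ∃ (J : Fin 3 → ∀ y : M, EndT E y) (U : Set M), IsLocalFrame Q J U ∧ x ∈ U := by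
  obtain ⟨U, J, hU, hx, hs, hb⟩ := hQ.frame x
  exact ⟨J, U, ⟨hU, hs, hb⟩, hx⟩

variable {Q : ∀ x : M, Submodule ℝ (EndT E x)} {J : Fin 3 → ∀ y : M, EndT E y} {U : Set M} {x : M}

theorem IsLocalFrame.mem_nhds (hJ : IsLocalFrame Q J U) (hx : x ∈ U) : U ∈ 𝓝 x :=
  hJ.isOpen.mem_nhds hx

theorem IsLocalFrame.endDiffAt (hJ : IsLocalFrame Q J U) (hx : x ∈ U) (i : Fin 3) :
    EndDiffAt (J i) x :=
  ((hJ.smooth i x hx).contMDiffAt (hJ.mem_nhds hx)).mdifferentiableAt (by simp)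

variable [FiniteDimensional ℝ E] [T2Space M]

theorem IsLocalFrame.exists_vField (hJ : IsLocalFrame Q J U) (hx : x ∈ U) (i : Fin 3)
    (Y : VField E M) : ∃ S : VField E M, ∀ᶠ y in 𝓝 x, S y = J i y (Y y) := by
  refine exists_vField_eventuallyEq (hJ.mem_nhds hx) (σ := fun y => J i y (Y y)) ?_
  exact (hJ.smooth i).clm_bundle_apply Y.contMDiff.contMDiffOn

theorem contMDiffAt_frame_pairing (g : Metric E M) (hJ : IsLocalFrame Q J U) (hx : x ∈ U)
    (i : Fin 3) (Y Z : VField E M) :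
    CMDiffAt ∞ (fun y => metricₗ g y (J i y (Y y)) (Z y)) x := by
  obtain ⟨S, hS⟩ := hJ.exists_vField hx i Y
  refine (contMDiff_inner g S Z x).congr_of_eventuallyEq ?_
  filter_upwards [hS] with y hy
  rw [hy, metricₗ_apply]

omit [FiniteDimensional ℝ E] [T2Space M] in
theorem Theta_eventuallyEq (g : Metric E M) (hJ : IsLocalFrame Q J U) (hx : x ∈ U)
    (Y₁ Y₂ Y₃ Y₄ : VField E M) :
    (fun y => Theta g Q y (Y₁ y) (Y₂ y) (Y₃ y) (Y₄ y)) =ᶠ[𝓝 x]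
      ((fun y => metricₗ g y (J 0 y (Y₁ y)) (Y₂ y)) * (fun y => metricₗ g y (J 0 y (Y₃ y)) (Y₄ y))
      + (fun y => metricₗ g y (J 1 y (Y₁ y)) (Y₂ y)) * (fun y => metricₗ g y (J 1 y (Y₃ y)) (Y₄ y)))
      + (fun y => metricₗ g y (J 2 y (Y₁ y)) (Y₂ y)) *
        (fun y => metricₗ g y (J 2 y (Y₃ y)) (Y₄ y)) := by
  filter_upwards [hJ.mem_nhds hx] with y hy
  rw [Theta_apply (hJ.basis y hy), Fin.sum_univ_three]
  rfl

theorem IsAlmostQuaternionic.contMDiff_Theta {g : Metric E M} (hQ : IsAlmostQuaternionic g Q)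
    (Y₁ Y₂ Y₃ Y₄ : VField E M) :
    CMDiff ∞ (fun y => Theta g Q y (Y₁ y) (Y₂ y) (Y₃ y) (Y₄ y)) := by
  intro x
  obtain ⟨J, U, hJ, hx⟩ := hQ.exists_isLocalFrame x
  have h := fun i => contMDiffAt_frame_pairing g hJ hx i
  exact ((((h 0 Y₁ Y₂).mul (h 0 Y₃ Y₄)).add ((h 1 Y₁ Y₂).mul (h 1 Y₃ Y₄))).add
    ((h 2 Y₁ Y₂).mul (h 2 Y₃ Y₄))).congr_of_eventuallyEq (Theta_eventuallyEq g hJ hx _ _ _ _)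

/-- A derivation of the fundamental form is the alternation of its value on `Θ`. -/
theorem deriv₄_fundForm {g : Metric E M} (hQ : IsAlmostQuaternionic g Q) (X : VField E M)
    (L : VField E M → VField E M) (Y₁ Y₂ Y₃ Y₄ : VField E M) (x : M) :
    deriv₄ X L (fundForm g Q) Y₁ Y₂ Y₃ Y₄ x =
      2 * (deriv₄ X L (fun x a b c d => Theta g Q x a b c d) Y₁ Y₂ Y₃ Y₄ x
        - deriv₄ X L (fun x a b c d => Theta g Q x a b c d) Y₁ Y₃ Y₂ Y₄ x
        + deriv₄ X L (fun x a b c d => Theta g Q x a b c d) Y₁ Y₄ Y₂ Y₃ x) := by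
  have hd : ∀ Y₁ Y₂ Y₃ Y₄ : VField E M,
      MDiffAt (fun y => Theta g Q y (Y₁ y) (Y₂ y) (Y₃ y) (Y₄ y)) x :=
    fun Y₁ Y₂ Y₃ Y₄ => (hQ.contMDiff_Theta Y₁ Y₂ Y₃ Y₄ x).mdifferentiableAt (by simp)
  have h : dirDeriv X (fun y => fundForm g Q y (Y₁ y) (Y₂ y) (Y₃ y) (Y₄ y)) x =
      2 * (dirDeriv X (fun y => Theta g Q y (Y₁ y) (Y₂ y) (Y₃ y) (Y₄ y)) x
        - dirDeriv X (fun y => Theta g Q y (Y₁ y) (Y₃ y) (Y₂ y) (Y₄ y)) x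
        + dirDeriv X (fun y => Theta g Q y (Y₁ y) (Y₄ y) (Y₂ y) (Y₃ y)) x) := by
    have h1 := (hd Y₁ Y₂ Y₃ Y₄).sub (hd Y₁ Y₃ Y₂ Y₄)
    have h2 := h1.add (hd Y₁ Y₄ Y₂ Y₃)
    simp only [dirDeriv]
    change mvfderiv 𝓘(ℝ, E) ((fun _ => (2 : ℝ)) *
      ((fun y => Theta g Q y (Y₁ y) (Y₂ y) (Y₃ y) (Y₄ y))
      - (fun y => Theta g Q y (Y₁ y) (Y₃ y) (Y₂ y) (Y₄ y))
      + (fun y => Theta g Q y (Y₁ y) (Y₄ y) (Y₂ y) (Y₃ y)))) x (X x) = _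
    rw [mvfderiv_mul mdifferentiableAt_const h2, mvfderiv_const, mvfderiv_add h1 (hd _ _ _ _),
      mvfderiv_sub (hd _ _ _ _) (hd _ _ _ _), smul_zero, add_zero]
    rfl
  simp only [deriv₄, h]
  simp only [fundForm]
  ring

/-- The Levi-Civita derivative of the forms `ω_i` of a local quaternionic frame is given by a
skew-symmetric infinitesimal deformation `C` of the frame. -/
theorem exists_frame_derivative {g : Metric E M} {D : Conn E M} [D.ContMDiffCovariantDerivative ∞]
    (hD : IsLeviCivita g D) (hQ : IsAlmostQuaternionic g Q) (hJ : IsLocalFrame Q J U) (hx : x ∈ U)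
    (X : VField E M) :
    ∃ C : Fin 3 → Tan E x →ₗ[ℝ] Tan E x,
      (∀ i u v, metricₗ g x (C i u) v = -metricₗ g x u (C i v)) ∧
      (∀ i v, C (i + 2) v = C i (J (i + 1) x v) + J i x (C (i + 1) v)) ∧
      (∀ i v, -C (i + 2) v = C (i + 1) (J i x v) + J (i + 1) x (C i v)) ∧
      ∀ i (Y Z : VField E M), dirDeriv X (fun y => metricₗ g y (J i y (Y y)) (Z y)) x =
        metricₗ g x (C i (Y x)) (Z x) + metricₗ g x (J i x (nabla D X Y x)) (Z x)
          + metricₗ g x (J i x (Y x)) (nabla D X Z x) := by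
  choose C hC using fun i => exists_endomorphism_derivative D (hJ.endDiffAt hx i) (X x)
  have hder : ∀ i (Y Z : VField E M), dirDeriv X (fun y => metricₗ g y (J i y (Y y)) (Z y)) x =
        metricₗ g x (C i (Y x)) (Z x) + metricₗ g x (J i x (nabla D X Y x)) (Z x)
          + metricₗ g x (J i x (Y x)) (nabla D X Z x) := by
    intro i Y Z
    obtain ⟨S, hS⟩ := hJ.exists_vField hx i Y
    have h1 : (fun y => metricₗ g y (J i y (Y y)) (Z y)) =ᶠ[𝓝 x]
        (fun y => g.inner y (S y) (Z y)) := by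
      filter_upwards [hS] with y hy
      rw [hy, metricₗ_apply]
    have h2 : nabla D X S x = C i (Y x) + J i x (nabla D X Y x) := by
      rw [nabla_apply, conn_congr D (S.diffAt x) hS, hC i _ (Y.diffAt x)]
      rfl
    rw [dirDeriv_congr X h1, hD.metric, h2, hS.self_of_nhds, ← metricₗ_apply, ← metricₗ_apply,
      map_add, LinearMap.add_apply]
  have hq := fun y hy => hQ.isQuatTriple (hJ.basis y hy)
  refine ⟨fun i => (C i : Tan E x →ₗ[ℝ] Tan E x), fun i u v => ?_, fun i v => ?_,
    fun i v => ?_, hder⟩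
  · obtain ⟨Y, rfl⟩ := exists_vField_apply_eq u
    obtain ⟨Z, rfl⟩ := exists_vField_apply_eq v
    have h1 : (fun y => metricₗ g y (J i y (Y y)) (Z y)) =ᶠ[𝓝 x]
        -(fun y => metricₗ g y (J i y (Z y)) (Y y)) := by
      filter_upwards [hJ.mem_nhds hx] with y hy
      rw [Pi.neg_apply, metricₗ_symm g y (J i y (Z y))]
      exact (hq y hy).skew i _ _
    have h2 := dirDeriv_congr X h1
    have h3 : dirDeriv X (-(fun y => metricₗ g y (J i y (Z y)) (Y y))) x =
        -dirDeriv X (fun y => metricₗ g y (J i y (Z y)) (Y y)) x := by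
      simp only [dirDeriv]
      rw [mvfderiv_neg]; rfl
    rw [h3, hder, hder] at h2
    have s1 := (hq x hx).skew i (nabla D X Y x) (Z x)
    have s2 := (hq x hx).skew i (nabla D X Z x) (Y x)
    simp only [ContinuousLinearMap.coe_coe] at s1 s2 ⊢
    rw [metricₗ_symm g x (Y x)]
    rw [metricₗ_symm g x (J i x (Z x)), metricₗ_symm g x (J i x (Y x))] at h2
    linarith
  · obtain ⟨Y, rfl⟩ := exists_vField_apply_eq v
    have h1 : ∀ᶠ y in 𝓝 x, J (i + 2) y (Y y) = J i y (J (i + 1) y (Y y)) := by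
      filter_upwards [hJ.mem_nhds hx] with y hy
      exact ((hq y hy).mul i (Y y)).symm
    have hd := (hJ.endDiffAt hx (i + 1)).apply (Y.diffAt x)
    have h2 := congrArg (fun T : Tan E x →L[ℝ] Tan E x => T (X x))
      (conn_congr D ((hJ.endDiffAt hx (i + 2)).apply (Y.diffAt x)) h1)
    beta_reduce at h2
    rw [hC _ _ (Y.diffAt x), hC _ _ hd, hC _ _ (Y.diffAt x), map_add] at h2
    have h3 := (hq x hx).mul i (D (fun y => Y y) x (X x))
    simp only [ContinuousLinearMap.coe_coe] at h3 ⊢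
    rw [h3, ← add_assoc] at h2
    exact add_right_cancel h2
  · obtain ⟨Y, rfl⟩ := exists_vField_apply_eq v
    have h1 : ∀ᶠ y in 𝓝 x, (-1 : ℝ) • J (i + 2) y (Y y) = J (i + 1) y (J i y (Y y)) := by
      filter_upwards [hJ.mem_nhds hx] with y hy
      rw [neg_one_smul]
      exact ((hq y hy).mul_rev i (Y y)).symm
    have hd := (hJ.endDiffAt hx i).apply (Y.diffAt x)
    have hd2 := (hJ.endDiffAt hx (i + 2)).apply (Y.diffAt x)
    have h2 := congrArg (fun T : Tan E x →L[ℝ] Tan E x => T (X x))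
      (conn_congr D (σ := (-1 : ℝ) • fun y => J (i + 2) y (Y y))
        (mdifferentiableAt_const.smul_section hd2) h1)
    beta_reduce at h2
    rw [D.isCovariantDerivativeOnUniv.smul_const _ hd2] at h2
    change (-1 : ℝ) • D (fun y => J (i + 2) y (Y y)) x (X x) = _ at h2
    rw [hC _ _ (Y.diffAt x), hC _ _ hd, hC _ _ (Y.diffAt x), map_add] at h2
    have h3 := (hq x hx).mul_rev i (D (fun y => Y y) x (X x))
    simp only [ContinuousLinearMap.coe_coe] at h3 ⊢
    rw [h3, ← add_assoc, smul_add, neg_one_smul, neg_one_smul] at h2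
    exact add_right_cancel h2

/-- `∇ Θ^∧ = 0` implies `∇ Θ = 0`: the derivative of a local quaternionic frame is a rotation of
the frame, and `Θ` is invariant under rotations. -/
theorem IsQuaternionicKaehler.deriv₄_Theta [Nontrivial E] {g : Metric E M} {D : Conn E M}
    [D.ContMDiffCovariantDerivative ∞] (hD : IsLeviCivita g D) (hQ : IsQuaternionicKaehler g D Q)
    (X Y₁ Y₂ Y₃ Y₄ : VField E M) (x : M) :
    deriv₄ X (nabla D X) (fun x a b c d => Theta g Q x a b c d) Y₁ Y₂ Y₃ Y₄ x = 0 := by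
  have hA := hQ.toIsAlmostQuaternionic
  obtain ⟨J, U, hJ, hx⟩ := hA.exists_isLocalFrame x
  obtain ⟨C, hC, hmul, hrev, hder⟩ := exists_frame_derivative hD hA hJ hx X
  have hmd : ∀ i (Y Z : VField E M), MDiffAt (fun y => metricₗ g y (J i y (Y y)) (Z y)) x :=
    fun i Y Z => (contMDiffAt_frame_pairing g hJ hx i Y Z).mdifferentiableAt (by simp)
  have hT : ∀ Y₁ Y₂ Y₃ Y₄ : VField E M,
      deriv₄ X (nabla D X) (fun x a b c d => Theta g Q x a b c d) Y₁ Y₂ Y₃ Y₄ x =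
      ∑ i, (metricₗ g x (C i (Y₁ x)) (Y₂ x) * metricₗ g x (J i x (Y₃ x)) (Y₄ x)
        + metricₗ g x (J i x (Y₁ x)) (Y₂ x) * metricₗ g x (C i (Y₃ x)) (Y₄ x)) := by
    intro Y₁ Y₂ Y₃ Y₄
    have hm : ∀ i, MDiffAt ((fun y => metricₗ g y (J i y (Y₁ y)) (Y₂ y)) *
        (fun y => metricₗ g y (J i y (Y₃ y)) (Y₄ y))) x := fun i => (hmd i _ _).mul (hmd i _ _)
    simp only [deriv₄]
    rw [dirDeriv_congr X (Theta_eventuallyEq g hJ hx Y₁ Y₂ Y₃ Y₄),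
      dirDeriv_add X ((hm 0).add (hm 1)) (hm 2), dirDeriv_add X (hm 0) (hm 1),
      dirDeriv_mul X (hmd _ _ _) (hmd _ _ _), dirDeriv_mul X (hmd _ _ _) (hmd _ _ _),
      dirDeriv_mul X (hmd _ _ _) (hmd _ _ _)]
    simp only [hder, Theta_apply (hJ.basis x hx), Fin.sum_univ_three]
    ring
  have hn : ∑ k, metricₗ g x (tanBasis x k) (dualBasis g x k) ≠ 0 := by
    rw [sum_metricₗ_dualBasis]
    exact_mod_cast (finrank_pos (R := ℝ) (M := E)).ne'
  have : Nontrivial (Tan E x) := inferInstanceAs (Nontrivial E)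
  have hq := hA.isQuatTriple (hJ.basis x hx)
  obtain ⟨β, hβ⟩ := hq.exists_cross_of_alternation_eq_zero (isDualPair_dualBasis g x) hn C hC hmul
    hrev (fun a b c d => by
      obtain ⟨Z₁, rfl⟩ := exists_vField_apply_eq a
      obtain ⟨Z₂, rfl⟩ := exists_vField_apply_eq b
      obtain ⟨Z₃, rfl⟩ := exists_vField_apply_eq c
      obtain ⟨Z₄, rfl⟩ := exists_vField_apply_eq d
      have h := hQ.parallel X Z₁ Z₂ Z₃ Z₄ x
      rw [deriv₄_fundForm hA, hT, hT, hT] at h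
      exact (mul_eq_zero.1 h).resolve_left two_ne_zero)
  have h0 := hβ ![1, 0, 0]
  have h1 := hβ ![0, 1, 0]
  have h2 := hβ ![0, 0, 1]
  simp [Fin.sum_univ_three, imag_apply, cross_apply] at h0 h1 h2
  rw [hT]
  simp only [Fin.sum_univ_three, h0, h1, h2, map_add, map_neg, map_smul, LinearMap.add_apply,
    LinearMap.neg_apply, LinearMap.smul_apply, smul_eq_mul]
  ring

end ParallelTheta

/-! ### Killing fields and curvature -/

section Killing

open Topology Matrix

variable {E : Type*} [NormedAddCommGroup E] [NormedSpace ℝ E]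
  {M : Type*} [TopologicalSpace M] [ChartedSpace E M] [IsManifold 𝓘(ℝ, E) ∞ M]
  {g : Metric E M} {Q : ∀ x : M, Submodule ℝ (EndT E x)} {x : M}

theorem IsAlmostQuaternionic.exists_isQuatBasis (hQ : IsAlmostQuaternionic g Q) (x : M) :
    ∃ J : Fin 3 → EndT E x, IsQuatBasis (Q x) J := by
  obtain ⟨U, J, -, hx, -, hb⟩ := hQ.frame x
  exact ⟨_, hb x hx⟩

theorem IsAlmostQuaternionic.theta_sub (hQ : IsAlmostQuaternionic g Q) (x : M) :
    (∀ a a' b c d, Theta g Q x (a - a') b c d = Theta g Q x a b c d - Theta g Q x a' b c d) ∧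
    (∀ a b b' c d, Theta g Q x a (b - b') c d = Theta g Q x a b c d - Theta g Q x a b' c d) ∧
    (∀ a b c c' d, Theta g Q x a b (c - c') d = Theta g Q x a b c d - Theta g Q x a b c' d) ∧
    (∀ a b c d d', Theta g Q x a b c (d - d') = Theta g Q x a b c d - Theta g Q x a b c d') := by
  obtain ⟨J, hJ⟩ := hQ.exists_isQuatBasis x
  refine ⟨fun a a' b c d => ?_, fun a b b' c d => ?_, fun a b c c' d => ?_,
    fun a b c d d' => ?_⟩ <;>
  rw [Theta_apply hJ, Theta_apply hJ, Theta_apply hJ] <;>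
  simp only [map_sub, LinearMap.sub_apply, sub_mul, mul_sub, Finset.sum_sub_distrib]

theorem IsAlmostQuaternionic.theta_swap (hQ : IsAlmostQuaternionic g Q) (a b c d : Tan E x) :
    Theta g Q x a b c d = -Theta g Q x b a c d := by
  obtain ⟨J, hJ⟩ := hQ.exists_isQuatBasis x
  simp only [Theta_apply hJ, ← Finset.sum_neg_distrib]
  refine Finset.sum_congr rfl fun i _ => ?_
  have h := (hQ.isQuatTriple hJ).skew i a b
  simp only [ContinuousLinearMap.coe_coe] at h
  rw [h, metricₗ_symm g x a]
  ring

/-- The forms `ω_i` of a quaternionic basis are linearly independent. -/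
theorem IsAlmostQuaternionic.coeff_eq_zero [Nontrivial E] (hQ : IsAlmostQuaternionic g Q)
    {J : Fin 3 → EndT E x} (hJ : IsQuatBasis (Q x) J) {s : Fin 3 → ℝ}
    (hs : ∀ u v, ∑ i, s i * metricₗ g x (J i u) v = 0) : s = 0 := by
  have : Nontrivial (Tan E x) := inferInstanceAs (Nontrivial E)
  obtain ⟨z, hz⟩ := exists_ne (0 : Tan E x)
  refine (hQ.isQuatTriple hJ).eq_zero_of_imag_apply hz ?_
  by_contra h
  refine (metricₗ_pos g x _ h).ne' ?_
  rw [← hs z (imag (fun i => (J i : Tan E x →ₗ[ℝ] Tan E x)) s z)]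
  nth_rewrite 1 [imag_apply]
  rw [Fin.sum_univ_three]
  simp only [map_add, map_smul, LinearMap.add_apply, LinearMap.smul_apply, smul_eq_mul,
    ContinuousLinearMap.coe_coe]

/-- A skew-symmetric endomorphism which annihilates the fundamental form normalises `Q`: its
commutators with `Q` are infinitesimal rotations. -/
theorem IsAlmostQuaternionic.exists_rotation [FiniteDimensional ℝ E] [Nontrivial E]
    (hQ : IsAlmostQuaternionic g Q)
    {J : Fin 3 → EndT E x} (hJ : IsQuatBasis (Q x) J) (A : Tan E x →ₗ[ℝ] Tan E x)
    (hA : ∀ u v, metricₗ g x (A u) v = -metricₗ g x u (A v))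
    (h : ∀ a b c d, fundForm g Q x (A a) b c d + fundForm g Q x a (A b) c d
      + fundForm g Q x a b (A c) d + fundForm g Q x a b c (A d) = 0) :
    ∃ β : Fin 3 → ℝ, ∀ c v, imag (fun i => (J i : Tan E x →ₗ[ℝ] Tan E x)) c (A v)
      - A (imag (fun i => (J i : Tan E x →ₗ[ℝ] Tan E x)) c v)
      = imag (fun i => (J i : Tan E x →ₗ[ℝ] Tan E x)) (c ⨯₃ β) v := by
  have : Nontrivial (Tan E x) := inferInstanceAs (Nontrivial E)
  have hq := hQ.isQuatTriple hJ
  have hn : ∑ k, metricₗ g x (tanBasis x k) (dualBasis g x k) ≠ 0 := by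
    rw [sum_metricₗ_dualBasis]
    exact_mod_cast (finrank_pos (R := ℝ) (M := E)).ne'
  have hsq := hq.mul
  have hrev := hq.mul_rev
  have hskew := hq.skew
  simp only [ContinuousLinearMap.coe_coe] at hsq hrev hskew
  set C : Fin 3 → Tan E x →ₗ[ℝ] Tan E x := fun i => (J i : Tan E x →ₗ[ℝ] Tan E x) ∘ₗ A
    - A ∘ₗ (J i : Tan E x →ₗ[ℝ] Tan E x) with hCdef
  have hCa : ∀ i v, C i v = J i (A v) - A (J i v) := fun i v => rfl
  have hs : ∀ i u v, metricₗ g x (C i u) v =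
      metricₗ g x (J i (A u)) v + metricₗ g x (J i u) (A v) := by
    intro i u v
    rw [hCa, map_sub, LinearMap.sub_apply, hA, sub_neg_eq_add]
  have hΘ : ∀ a b c d, Theta g Q x (A a) b c d + Theta g Q x a (A b) c d
      + Theta g Q x a b (A c) d + Theta g Q x a b c (A d) =
      ∑ i, (metricₗ g x (C i a) b * metricₗ g x (J i c) d
        + metricₗ g x (J i a) b * metricₗ g x (C i c) d) := by
    intro a b c d
    simp only [Theta_apply hJ, ← Finset.sum_add_distrib, hs]
    refine Finset.sum_congr rfl fun i _ => ?_
    ring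
  obtain ⟨β, hβ⟩ := hq.exists_cross_of_alternation_eq_zero (isDualPair_dualBasis g x) hn C
    (fun i u v => by
      rw [hs, hCa, map_sub, hskew i (A u) v, hA u, hskew i u (A v)]
      ring)
    (fun i v => by
      simp only [ContinuousLinearMap.coe_coe, hCa, map_sub, ← hsq]
      abel)
    (fun i v => by
      have h1 := hrev i (A v)
      have h2 := hrev i v
      simp only [ContinuousLinearMap.coe_coe, hCa, map_sub, h1, h2, map_neg]
      abel)
    (fun a b c d => by
      simp only [ContinuousLinearMap.coe_coe]
      rw [← hΘ, ← hΘ, ← hΘ]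
      have h1 := h a b c d
      simp only [fundForm] at h1
      linarith)
  refine ⟨β, fun c v => ?_⟩
  rw [← hβ, imag_apply, imag_apply, Fin.sum_univ_three]
  simp only [hCa, ContinuousLinearMap.coe_coe, map_add, map_smul, smul_sub]
  abel

variable [FiniteDimensional ℝ E] {D : Conn E M} [D.ContMDiffCovariantDerivative ∞]

theorem IsLeviCivita.lieBr_apply (hD : IsLeviCivita g D) (X Y : VField E M) (x : M) :
    lieBr X Y x = nabla D X Y x - nabla D Y X x := by
  rw [← hD.torsion_free]; rfl

variable (D) in
/-- The endomorphism `u ↦ ∇_u V` of the tangent space. -/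
def covDeriv (V : VField E M) (x : M) : Tan E x →ₗ[ℝ] Tan E x :=
  (D (fun y => V y) x : Tan E x →L[ℝ] Tan E x)

omit [FiniteDimensional ℝ E] in
theorem nabla_eq_covDeriv (V X : VField E M) (x : M) :
    nabla D X V x = covDeriv D V x (X x) := rfl

variable [T2Space M]

/-- The Killing equation. -/
theorem IsQKKilling.covDeriv_skew {V : VField E M} (hV : IsQKKilling g Q V)
    (hD : IsLeviCivita g D) (u v : Tan E x) :
    metricₗ g x (covDeriv D V x u) v = -metricₗ g x u (covDeriv D V x v) := by
  obtain ⟨X, rfl⟩ := exists_vField_apply_eq u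
  obtain ⟨Y, rfl⟩ := exists_vField_apply_eq v
  have h := hV.killing X Y x
  rw [hD.metric, hD.lieBr_apply, hD.lieBr_apply] at h
  simp only [← metricₗ_apply] at h
  simp only [map_sub, LinearMap.sub_apply, nabla_eq_covDeriv V] at h
  linarith

/-- `ℒ_V - ∇_V` acts on tensors as the endomorphism `∇V`, up to sign. -/
theorem IsQKKilling.covDeriv_fundForm {V : VField E M} (hV : IsQKKilling g Q V)
    (hD : IsLeviCivita g D) (hQ : IsQuaternionicKaehler g D Q) (a b c d : Tan E x) :
    fundForm g Q x (covDeriv D V x a) b c d + fundForm g Q x a (covDeriv D V x b) c d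
      + fundForm g Q x a b (covDeriv D V x c) d + fundForm g Q x a b c (covDeriv D V x d) = 0 := by
  obtain ⟨Y₁, rfl⟩ := exists_vField_apply_eq a
  obtain ⟨Y₂, rfl⟩ := exists_vField_apply_eq b
  obtain ⟨Y₃, rfl⟩ := exists_vField_apply_eq c
  obtain ⟨Y₄, rfl⟩ := exists_vField_apply_eq d
  obtain ⟨t1, t2, t3, t4⟩ := hQ.toIsAlmostQuaternionic.theta_sub x
  have h1 := hV.lie_fundForm Y₁ Y₂ Y₃ Y₄ x
  have h2 := hQ.parallel V Y₁ Y₂ Y₃ Y₄ x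
  simp only [deriv₄, hD.lieBr_apply] at h1 h2
  simp only [nabla_eq_covDeriv V, fundForm, t1, t2, t3, t4] at h1 h2 ⊢
  linarith

/-- `∇_X (Θ(V, W)) = Θ(∇_X V, W) + Θ(V, ∇_X W)`, because `Θ` is parallel. -/
theorem IsQuaternionicKaehler.nablaTensor₂_thetaForm [Nontrivial E]
    (hQ : IsQuaternionicKaehler g D Q) (hD : IsLeviCivita g D) (X V W Z₁ Z₂ : VField E M) (x : M) :
    nablaTensor₂ D X (ThetaForm g Q V W) Z₁ Z₂ x =
      Theta g Q x (covDeriv D V x (X x)) (W x) (Z₁ x) (Z₂ x)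
        + Theta g Q x (V x) (covDeriv D W x (X x)) (Z₁ x) (Z₂ x) := by
  have h := IsQuaternionicKaehler.deriv₄_Theta hD hQ X V W Z₁ Z₂ x
  simp only [deriv₄] at h
  rw [← nabla_eq_covDeriv, ← nabla_eq_covDeriv]
  change dirDeriv X (fun y => Theta g Q y (V y) (W y) (Z₁ y) (Z₂ y)) x
    - Theta g Q x (V x) (W x) (nabla D X Z₁ x) (Z₂ x)
    - Theta g Q x (V x) (W x) (Z₁ x) (nabla D X Z₂ x) = _
  linarith

omit [FiniteDimensional ℝ E] [T2Space M] in
theorem nablaTensor₂_zero (X : VField E M) : nablaTensor₂ D X 0 = 0 := by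
  funext Y Z x
  have h := dirDeriv_zero X x
  simp only [nablaTensor₂, Pi.sub_apply, Pi.zero_apply, sub_zero]
  exact h

omit [FiniteDimensional ℝ E] [T2Space M] in
theorem nablaTensor₂_neg (X : VField E M) (β : Tensor₂ E M) (Y Z : VField E M) (x : M) :
    nablaTensor₂ D X (-β) Y Z x = -nablaTensor₂ D X β Y Z x := by
  have h : dirDeriv X (-(β Y Z)) x = -dirDeriv X (β Y Z) x := by
    simp only [dirDeriv]
    rw [mvfderiv_neg]; rfl
  change dirDeriv X (-(β Y Z)) x - -β _ Z x - -β Y _ x = -(dirDeriv X (β Y Z) x - β _ Z x - β Y _ x)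
  rw [h]
  ring

/-- The curvature of a Levi-Civita connection is skew-symmetric, by the Ricci identity for `g`. -/
theorem IsLeviCivita.curvField_skew [Nontrivial E] (hD : IsLeviCivita g D)
    (X Y Z W : VField E M) (x : M) :
    metricₗ g x (curvField D X Y Z x) (W x) = -metricₗ g x (Z x) (curvField D X Y W x) := by
  have h0 : ∀ X : VField E M, nablaTensor₂ D X (Tensor₂.ofField fun x => g.inner x) = 0 := by
    intro X
    funext Y Z x
    have h := hD.metric X Y Z x
    change dirDeriv X (fun y => g.inner y (Y y) (Z y)) x - g.inner x (nabla D X Y x) (Z x)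
      - g.inner x (Y x) (nabla D X Z x) = 0
    linarith
  have h := ricci_identity₂ D (fun x => g.inner x) (contMDiff_inner g)
    (fun X Z W => by rw [h0]; exact mdifferentiable_const) X Y Z W x
  simp only [h0, nablaTensor₂_zero, Pi.zero_apply, sub_zero] at h
  simp only [metricₗ_apply]
  linarith

theorem IsQuaternionicKaehler.curvField_theta [Nontrivial E]
    (hQ : IsQuaternionicKaehler g D Q) (hD : IsLeviCivita g D)
    (X Y Z₁ Z₂ Z₃ Z₄ : VField E M) (x : M) :
    Theta g Q x (curvField D X Y Z₁ x) (Z₂ x) (Z₃ x) (Z₄ x)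
      + Theta g Q x (Z₁ x) (curvField D X Y Z₂ x) (Z₃ x) (Z₄ x)
      + Theta g Q x (Z₁ x) (Z₂ x) (curvField D X Y Z₃ x) (Z₄ x)
      + Theta g Q x (Z₁ x) (Z₂ x) (Z₃ x) (curvField D X Y Z₄ x) = 0 := by
  have hs := hQ.toIsAlmostQuaternionic.theta_sub
  exact curvField_annihilates D (fun x a b c d => Theta g Q x a b c d)
    (fun x => (hs x).1) (fun x => (hs x).2.1) (fun x => (hs x).2.2.1) (fun x => (hs x).2.2.2)
    hQ.toIsAlmostQuaternionic.contMDiff_Theta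
    (IsQuaternionicKaehler.deriv₄_Theta hD hQ) X Y Z₁ Z₂ Z₃ Z₄ x

/-- On a quaternionic Kähler manifold of dimension `≠ 4` with non-vanishing scalar curvature, no
non-zero form `ω_q`, `q ∈ Q`, is annihilated by the curvature. -/
theorem IsQuaternionicKaehler.eq_zero_of_curvField_annihilates [Nontrivial E]
    (hdim : finrank ℝ E ≠ 4) (hQ : IsQuaternionicKaehler g D Q) (hD : IsLeviCivita g D)
    (hscal : scalarCurvature g D x ≠ 0) {q : EndT E x} (hq : q ∈ Q x)
    (h : ∀ X Y Z W : VField E M, omega g x q (curvField D X Y Z x) (W x)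
      + omega g x q (Z x) (curvField D X Y W x) = 0) :
    q = 0 := by
  have : Nontrivial (Tan E x) := inferInstanceAs (Nontrivial E)
  have hA := hQ.toIsAlmostQuaternionic
  obtain ⟨J, hJ⟩ := hA.exists_isQuatBasis x
  obtain ⟨e, R, he, hRe, hR⟩ := exists_curvature_linearMap D x
  have hRs : ∀ u v w z, metricₗ g x (R u v w) z = -metricₗ g x w (R u v z) := by
    intro u v w z
    have h1 := hD.curvField_skew (e u) (e v) (e w) (e z) x
    rwa [← hRe, ← hRe, he, he] at h1
  have hb := isDualPair_dualBasis g x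
  rw [← hJ.span] at hq
  obtain ⟨c, hc⟩ := (Submodule.mem_span_range_iff_exists_fun ℝ).1 hq
  have hqc : ∀ v, q v = imag (fun i => (J i : Tan E x →ₗ[ℝ] Tan E x)) c v := by
    intro v
    rw [← hc, imag_apply, Fin.sum_univ_three]
    rfl
  have hcomm : ∀ u v w, R u v (imag (fun i => (J i : Tan E x →ₗ[ℝ] Tan E x)) c w) =
      imag (fun i => (J i : Tan E x →ₗ[ℝ] Tan E x)) c (R u v w) := by
    intro u v w
    refine sub_eq_zero.1 (hb.eq_zero fun z => ?_)
    have h1 := h (e u) (e v) (e w) (e z)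
    rw [← hRe, ← hRe, he, he] at h1
    change metricₗ g x (q (R u v w)) z + metricₗ g x (q w) (R u v z) = 0 at h1
    rw [hqc, hqc] at h1
    rw [map_sub, LinearMap.sub_apply, hRs]
    linarith
  have hc0 : c = 0 := by
    by_contra hc0
    refine hscal ?_
    rw [scalarCurvature_eq g D x R hR]
    refine (hA.isQuatTriple hJ).scalar_eq_zero_of_commute hb ?_ ?_ R ?_ ?_ ?_ hc0 hcomm
    · rw [sum_metricₗ_dualBasis]
      exact_mod_cast (finrank_pos (R := ℝ) (M := E)).ne'
    · rw [sum_metricₗ_dualBasis]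
      exact_mod_cast hdim
    · intro u v w
      rw [hRe, hRe, curvField_antisymm]
      rfl
    · intro u v w
      rw [hRe, hRe, hRe]
      exact congrArg (fun S : VField E M => S x) (hD.bianchi (e u) (e v) (e w))
    · intro u v
      refine hA.exists_rotation hJ (R u v) (hRs u v) fun a b c d => ?_
      have hΘ : ∀ a b c d, Theta g Q x (R u v a) b c d + Theta g Q x a (R u v b) c d
          + Theta g Q x a b (R u v c) d + Theta g Q x a b c (R u v d) = 0 := by
        intro a b c d
        have h1 := hQ.curvField_theta hD (e u) (e v) (e a) (e b) (e c) (e d) x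
        simpa only [← hRe, he] using h1
      have h1 := hΘ a b c d
      have h2 := hΘ a c b d
      have h3 := hΘ a d b c
      simp only [fundForm]
      linarith
  rw [← hc, hc0]
  simp

end Killing

/-! ### Momentum maps -/

section MomentumMap

open Matrix

variable {E : Type*} [NormedAddCommGroup E] [NormedSpace ℝ E] [FiniteDimensional ℝ E]
  {M : Type*} [TopologicalSpace M] [ChartedSpace E M] [IsManifold 𝓘(ℝ, E) ∞ M]
  {g : Metric E M} {Q : ∀ x : M, Submodule ℝ (EndT E x)} {x : M}
  {D : Conn E M} [D.ContMDiffCovariantDerivative ∞] {K : LieSubbundle E M} {𝔨 : Submodule ℝ K.Sec}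
  {f : K.QForm g Q} [T2Space M] [Nontrivial E]

/-- Differentiating `f_[V,W] = -Θ(V, W)` gives `[J, ∇W] V = [J, ∇V] W` for `J ∈ Q`. -/
theorem commutator_covDeriv_symm (hQ : IsQuaternionicKaehler g D Q) (hD : IsLeviCivita g D)
    (h𝔨 : K.IsKillingGenerator g Q 𝔨) (hf : IsGLMomentumMap D 𝔨 f)
    (hbr : ∀ V₁ ∈ 𝔨, ∀ V₂ ∈ 𝔨,
        f.app (K.br V₁ V₂) = -ThetaForm g Q (K.anchor V₁) (K.anchor V₂))
    {V W : K.Sec} (hV : V ∈ 𝔨) (hW : W ∈ 𝔨) {J : Fin 3 → EndT E x} (hJ : IsQuatBasis (Q x) J)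
    (i : Fin 3) :
    J i (covDeriv D W.1 x (V.1 x)) - covDeriv D W.1 x (J i (V.1 x)) =
      J i (covDeriv D V.1 x (W.1 x)) - covDeriv D V.1 x (J i (W.1 x)) := by
  have hA := hQ.toIsAlmostQuaternionic
  have hAV := fun u v => (h𝔨.killing V hV).covDeriv_skew hD (x := x) u v
  have hAW := fun u v => (h𝔨.killing W hW).covDeriv_skew hD (x := x) u v
  have hs := (hA.isQuatTriple hJ).skew
  simp only [ContinuousLinearMap.coe_coe] at hs
  refine sub_eq_zero.1 ((isDualPair_dualBasis g x).eq_zero fun u => ?_)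
  obtain ⟨X, rfl⟩ := exists_vField_apply_eq u
  -- The coefficients in the forms `ω_i` of the `X`-derivative of `f_[V,W] + Θ(V, W)`, where
  -- `[V, W] = A_W V - A_V W`.
  have h0 : (fun i => metricₗ g x (J i (covDeriv D W.1 x (V.1 x) - covDeriv D V.1 x (W.1 x))) (X x)
      + metricₗ g x (J i (covDeriv D V.1 x (X x))) (W.1 x)
      + metricₗ g x (J i (V.1 x)) (covDeriv D W.1 x (X x))) = 0 := by
    refine hA.coeff_eq_zero hJ fun z₁ z₂ => ?_
    obtain ⟨Z₁, rfl⟩ := exists_vField_apply_eq z₁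
    obtain ⟨Z₂, rfl⟩ := exists_vField_apply_eq z₂
    have h1 := congrFun (congrFun (congrFun (hf _ (h𝔨.bracket V hV W hW) X) Z₁) Z₂) x
    rw [hbr V hV W hW, nablaTensor₂_neg, hQ.nablaTensor₂_thetaForm hD] at h1
    change _ = Theta g Q x (lieBr V.1 W.1 x) (X x) (Z₁ x) (Z₂ x) at h1
    rw [hD.lieBr_apply, nabla_eq_covDeriv, nabla_eq_covDeriv] at h1
    simp only [Theta_apply hJ, LieSubbundle.anchor] at h1
    simp only [add_mul, Finset.sum_add_distrib]
    linarith
  have h1 := congrFun h0 i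
  simp only [map_sub, LinearMap.sub_apply, Pi.zero_apply, hs i (covDeriv D V.1 x (X x)),
    hAV (X x)] at h1
  rw [metricₗ_symm g x _ (covDeriv D W.1 x (X x)), hAW, metricₗ_symm g x (X x),
    metricₗ_symm g x (X x)] at h1
  simp only [map_sub, LinearMap.sub_apply]
  linarith

/-- If `f_[V,W] = -Θ(V, W)` on `𝔨`, the endomorphisms `∇V`, `V ∈ 𝔨`, commute with `Q` at all points
where `K` is non-zero. -/
theorem commute_covDeriv (hQ : IsQuaternionicKaehler g D Q) (hD : IsLeviCivita g D)
    (hK : K.IsInvariant D) (h𝔨 : K.IsKillingGenerator g Q 𝔨) (hf : IsGLMomentumMap D 𝔨 f)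
    (hbr : ∀ V₁ ∈ 𝔨, ∀ V₂ ∈ 𝔨,
        f.app (K.br V₁ V₂) = -ThetaForm g Q (K.anchor V₁) (K.anchor V₂))
    {V : K.Sec} (hV : V ∈ 𝔨) {J : Fin 3 → EndT E x} (hJ : IsQuatBasis (Q x) J)
    (hne : ∃ v ∈ K.fiber x, v ≠ 0) (i : Fin 3) (v : Tan E x) :
    J i (covDeriv D V.1 x v) = covDeriv D V.1 x (J i v) := by
  have hA := hQ.toIsAlmostQuaternionic
  choose β hβ using fun W : 𝔨 => hA.exists_rotation hJ (covDeriv D W.1.1 x)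
    (fun u v => (h𝔨.killing W.1 W.2).covDeriv_skew hD u v)
    (fun a b c d => (h𝔨.killing W.1 W.2).covDeriv_fundForm hD hQ a b c d)
  have hβ0 : β ⟨V, hV⟩ = 0 := by
    refine (hA.isQuatTriple hJ).rotation_eq_zero (metricₗ_pos g x) (L := 𝔨)
      (fun W => W.1.1 x) (fun W => covDeriv D W.1.1 x) β
      (fun W u v => (h𝔨.killing W.1 W.2).covDeriv_skew hD u v) (fun W u => ?_) hβ
      (fun W W' c => ?_) ?_ _
    · obtain ⟨X, rfl⟩ := exists_vField_apply_eq u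
      obtain ⟨W', hW', h⟩ := h𝔨.generates x _ (hK X W.1 x)
      exact ⟨⟨W', hW'⟩, h⟩
    · rw [← hβ, ← hβ]
      have h := fun i => commutator_covDeriv_symm hQ hD h𝔨 hf hbr W'.2 W.2 hJ i
      simp only [imag_apply, map_add, map_smul, ContinuousLinearMap.coe_coe]
      linear_combination (norm := module) c 0 • h 0 + c 1 • h 1 + c 2 • h 2
    · obtain ⟨v, hv, h0⟩ := hne
      obtain ⟨W, hW, rfl⟩ := h𝔨.generates x v hv
      exact ⟨⟨W, hW⟩, h0⟩
  have h := hβ ⟨V, hV⟩ (Pi.single i 1) v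
  rw [hβ0] at h
  have h1 : ∀ w, imag (fun i => (J i : Tan E x →ₗ[ℝ] Tan E x)) (Pi.single i 1) w = J i w := by
    intro w
    simp [imag, Pi.single_apply, ite_smul]
  rw [h1, h1] at h
  simpa [imag, sub_eq_zero] using h

/-- If `f_[V,W] = -Θ(V, W)` on `𝔨`, then `f = 0`: by the Ricci identity `f_V` is annihilated by the
curvature. -/
theorem momentumMap_eq_zero (hdim : finrank ℝ E ≠ 4) (hQ : IsQuaternionicKaehler g D Q)
    (hD : IsLeviCivita g D) (hscal : ∀ x, scalarCurvature g D x ≠ 0)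
    (hK : K.IsInvariant D) (h𝔨 : K.IsKillingGenerator g Q 𝔨) (hf : IsGLMomentumMap D 𝔨 f)
    (hbr : ∀ V₁ ∈ 𝔨, ∀ V₂ ∈ 𝔨,
        f.app (K.br V₁ V₂) = -ThetaForm g Q (K.anchor V₁) (K.anchor V₂))
    {V : K.Sec} (hV : V ∈ 𝔨) (x : M) : f.val x ⟨V.1 x, V.2 x⟩ = 0 := by
  have hA := hQ.toIsAlmostQuaternionic
  by_cases hne : ∃ v ∈ K.fiber x, v ≠ 0
  swap
  · push Not at hne
    have h : (⟨V.1 x, V.2 x⟩ : K.fiber x) = 0 := Subtype.ext (hne _ (V.2 x))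
    rw [h, map_zero]
  obtain ⟨J, hJ⟩ := hA.exists_isQuatBasis x
  have hs := (hA.isQuatTriple hJ).skew
  simp only [ContinuousLinearMap.coe_coe] at hs
  obtain ⟨q, hq, hfq⟩ := f.mem x ⟨V.1 x, V.2 x⟩
  suffices h : q = 0 by
    rw [hfq, h]
    simp [omega]
  refine hQ.eq_zero_of_curvField_annihilates hdim hD (hscal x) hq fun X Y Z W => ?_
  have hR := ricci_identity₂ D (fun x => f.val x ⟨V.1 x, V.2 x⟩) (contMDiff_ofField (f.smooth V))
    (fun X Z W => by
      have h := hf V hV X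
      simp only [LieSubbundle.QForm.app] at h
      rw [h]
      exact (hA.contMDiff_Theta _ _ Z W).mdifferentiable (by simp)) X Y Z W x
  have hn : ∀ X, nablaTensor₂ D X (Tensor₂.ofField fun x => f.val x ⟨V.1 x, V.2 x⟩) =
      ThetaForm g Q V.1 X := hf V hV
  rw [hn, hn, hn, hQ.nablaTensor₂_thetaForm hD, hQ.nablaTensor₂_thetaForm hD, hfq] at hR
  have h1 : ThetaForm g Q V.1 (lieBr X Y) Z W x =
      Theta g Q x (V.1 x) (covDeriv D Y x (X x)) (Z x) (W x)
        - Theta g Q x (V.1 x) (covDeriv D X x (Y x)) (Z x) (W x) := by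
    change Theta g Q x (V.1 x) (lieBr X Y x) (Z x) (W x) = _
    rw [hD.lieBr_apply, (hA.theta_sub x).2.1, nabla_eq_covDeriv, nabla_eq_covDeriv]
  -- `J_i A_V` is symmetric, as a product of commuting skew-symmetric endomorphisms.
  have h2 : Theta g Q x (covDeriv D V.1 x (X x)) (Y x) (Z x) (W x) =
      Theta g Q x (covDeriv D V.1 x (Y x)) (X x) (Z x) (W x) := by
    simp only [Theta_apply hJ]
    refine Finset.sum_congr rfl fun i _ => ?_
    rw [hs i (covDeriv D V.1 x (Y x)), (h𝔨.killing V hV).covDeriv_skew hD (Y x),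
      commute_covDeriv hQ hD hK h𝔨 hf hbr hV hJ hne, metricₗ_symm g x (Y x), neg_neg]
  linarith

/-- If `f_[V,W] = -Θ(V, W)` on `𝔨`, then `K = 0`. -/
theorem fiber_eq_bot (hdim : finrank ℝ E ≠ 4) (hQ : IsQuaternionicKaehler g D Q)
    (hD : IsLeviCivita g D) (hscal : ∀ x, scalarCurvature g D x ≠ 0)
    (hK : K.IsInvariant D) (h𝔨 : K.IsKillingGenerator g Q 𝔨) (hf : IsGLMomentumMap D 𝔨 f)
    (hbr : ∀ V₁ ∈ 𝔨, ∀ V₂ ∈ 𝔨,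
        f.app (K.br V₁ V₂) = -ThetaForm g Q (K.anchor V₁) (K.anchor V₂)) (x : M) :
    K.fiber x = ⊥ := by
  refine (Submodule.eq_bot_iff _).2 fun v hv => ?_
  obtain ⟨V, hV, rfl⟩ := h𝔨.generates x v hv
  have hA := hQ.toIsAlmostQuaternionic
  obtain ⟨J, hJ⟩ := hA.exists_isQuatBasis x
  have h0 : f.app V = 0 := by
    funext Y Z y
    simp [LieSubbundle.QForm.app, Tensor₂.ofField,
      momentumMap_eq_zero hdim hQ hD hscal hK h𝔨 hf hbr hV y]
  -- As `∇ f_V = 0`, the form `Θ(V, J₀V) = ∑ᵢ ωᵢ(V, J₀V) ωᵢ` vanishes. Its value on `(V, J₀V)` is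
  -- `∑ᵢ ωᵢ(V, J₀V)²`, with first term `g(J₀V, J₀V)²`.
  obtain ⟨X, hX⟩ := exists_vField_apply_eq (J 0 (V.1 x))
  have h1 := congrFun (congrFun (congrFun (hf V hV X) V.1) X) x
  rw [h0, nablaTensor₂_zero] at h1
  change 0 = Theta g Q x (V.1 x) (X x) (V.1 x) (X x) at h1
  rw [Theta_apply hJ, hX] at h1
  have h2 : metricₗ g x (J 0 (V.1 x)) (J 0 (V.1 x)) = 0 :=
    mul_self_eq_zero.1 ((Finset.sum_eq_zero_iff_of_nonneg fun i _ => mul_self_nonneg _).1 h1.symm 0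
      (Finset.mem_univ _))
  have h3 : J 0 (V.1 x) = 0 := by
    by_contra h
    exact (metricₗ_pos g x _ h).ne' h2
  have h4 := (hA.isQuatTriple hJ).sq 0 (V.1 x)
  simp only [ContinuousLinearMap.coe_coe] at h4
  rw [h3, map_zero] at h4
  exact neg_eq_zero.1 h4.symm

end MomentumMap

end QuatKaehler

end

theorem theorem4p1
    {E : Type*} [NormedAddCommGroup E] [NormedSpace ℝ E] [FiniteDimensional ℝ E]
    {M : Type*} [TopologicalSpace M] [T2Space M] [SecondCountableTopology M]
    [ChartedSpace E M] [IsManifold 𝓘(ℝ, E) ∞ M]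
    (m : ℕ) (hm : 1 < m) (hdim : Module.finrank ℝ E = 4 * m)
    (g : QuatKaehler.Metric E M) (D : QuatKaehler.Conn E M) [D.ContMDiffCovariantDerivative ∞]
    (hD : QuatKaehler.IsLeviCivita g D)
    (Q : ∀ x : M, Submodule ℝ (QuatKaehler.EndT E x))
    (hQ : QuatKaehler.IsQuaternionicKaehler g D Q)
    (hscal : ∀ x : M, QuatKaehler.scalarCurvature g D x ≠ 0)
    (K : QuatKaehler.LieSubbundle E M) (hK : K.IsInvariant D)
    (𝔨 : Submodule ℝ K.Sec) (h𝔨 : K.IsKillingGenerator g Q 𝔨)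
    (f : K.QForm g Q) (hf : QuatKaehler.IsGLMomentumMap D 𝔨 f) :
    QuatKaehler.IsHomotopyMomentumSection (QuatKaehler.nablaTensor₂ D) (K.nablaK hK)
        K.anchor K.br (QuatKaehler.ThetaForm g Q) f.app ↔
      ∀ V₁ ∈ 𝔨, ∀ V₂ ∈ 𝔨,
        f.app (K.br V₁ V₂) = -QuatKaehler.ThetaForm g Q (K.anchor V₁) (K.anchor V₂) := by
  have : Nontrivial E := Module.nontrivial_of_finrank_pos (R := ℝ) (by omega)
  have hA := hQ.toIsAlmostQuaternionic
  constructor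
  · intro h V₁ h₁ V₂ h₂
    have h1 := h.eth_eq V₁ V₂
    rw [hf V₂ h₂, hf V₁ h₁] at h1
    funext Y Z x
    have h2 := congrFun (congrFun (congrFun h1 Y) Z) x
    have h3 := hA.theta_swap (V₂.1 x) (V₁.1 x) (Y x) (Z x)
    simp only [Pi.sub_apply, Pi.neg_apply, QuatKaehler.ThetaForm, QuatKaehler.Tensor₂.ofField,
      QuatKaehler.LieSubbundle.anchor] at h2 ⊢
    linarith
  · intro hbr
    -- All sections of `K` vanish, and so do all terms of the momentum equations.
    have hbot := QuatKaehler.fiber_eq_bot (by omega) hQ hD hscal hK h𝔨 hf hbr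
    have hval : ∀ V : K.Sec, V.1 = 0 := by
      intro V
      ext x
      have h := V.2 x
      rw [hbot x] at h
      exact (Submodule.mem_bot ℝ).1 h
    have happ : ∀ V : K.Sec, f.app V = 0 := by
      intro V
      funext Y Z x
      have h : (⟨V.1 x, V.2 x⟩ : K.fiber x) = 0 := by
        refine Subtype.ext ?_
        have h1 := congrArg (fun S : QuatKaehler.VField E M => S x) (hval V)
        exact h1
      simp [QuatKaehler.LieSubbundle.QForm.app, QuatKaehler.Tensor₂.ofField, h]
    have hΘ : ∀ (V : K.Sec) (X : QuatKaehler.VField E M),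
        QuatKaehler.ThetaForm g Q (K.anchor V) X = 0 := by
      intro V X
      funext Y Z x
      have h1 : K.anchor V x = X x - X x := by
        rw [sub_self]
        exact congrArg (fun S : QuatKaehler.VField E M => S x) (hval V)
      have h2 := (hA.theta_sub x).1 (X x) (X x) (X x) (Y x) (Z x)
      rw [← h1, sub_self] at h2
      exact h2
    refine ⟨fun X V => ?_, fun V W => ?_⟩
    · rw [happ, happ, hΘ, QuatKaehler.nablaTensor₂_zero, sub_zero]
    · rw [happ, happ, happ, hΘ, QuatKaehler.nablaTensor₂_zero, QuatKaehler.nablaTensor₂_zero,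
        sub_zero, sub_zero, neg_zero]
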